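/- Let $\Gamma\subset\mathbb R^3$ be a lattice and let $\mathbb T^3=\Gamma\backslash\mathbb R^3$, with local coordinates $x^1,x^2,x^3$ induced from $\mathbb R^3$. Let $a_1,b_2,b_3$ be smooth real functions on $[0,1]$ with $a_1(t)\neq 0$ and $l(t):=b_2(t)^2+b_3(t)^2>0$ for all $t$. Consider on $\mathbb T^3$ the time-dependent frame $$e_1(t)=a_1\,\partial_{x^1},\qquad e_2(t)=b_2\,\partial_{x^2}+b_3\,\partial_{x^3},\qquad e_3(t)=-b_3\,\partial_{x^2}+b_2\,\partial_{x^3}$$ and its dual coframe $$e^1(t)=\tfrac1{a_1}dx^1,\qquad e^2(t)=\tfrac{b_2}{l}dx^2+\tfrac{b_3}{l}dx^3,\qquad e^3(t)=-\tfrac{b_3}{l}dx^2+\tfrac{b_2}{l}dx^3 .$$ Put $v=b_2b_2'+b_3b_3'$ and $w=b_2b_3'-b_3b_2'$, and assume $\frac{v(1)}{l(1)}=\frac{v(0)}{l(0)}$ and $\frac{w(1)}{l(1)}=\frac{w(0)}{l(0)}$. Assume that there is a diffeomorphism $\rho$ of $\mathbb T^3$ with $\rho^*(e^i(1))=e^i(0)$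 for $i=1,2,3$, and that $\left(\frac1l\right)'\cdot\frac1{a_1}$ is a nonzero constant on $[0,1]$. Let $(N,J,k,\omega)$ be a compact Kähler manifold with complex structure $J$, metric $k$ and Kähler form $\omega$, and let $\psi$ be a diffeomorphism of $N$ that is holomorphic with respect to $J$ and satisfies $\psi^*\omega=\omega$. Let $f=(\rho,\psi)$ on $\mathbb T^3\times N$, and let $M_f=(\mathbb T^3\times N\times[0,1])/((x,p,0)\sim(\rho(x),\psi(p),1))$ be its mapping torus, with the smooth structure of the quotient of $\mathbb T^3\times N\times\mathbb R$ by the $\mathbb Z$-action generated by $(x,p,t)\mapsto(\rho(x),\psi(p),t+1)$. Then $M_f$ admits a split generalized Kähler structure $(I_\pm,g,\omega_\pm)$: a smooth Riemannian metric $g$ and two commuting complex structures $I_+,I_-$ compatible with $g$, with fundamental forms $\omega_\pm=g(I_\pm\cdot,\cdot)$, such that $d^c_+\omega_+=-d^c_-\omega_-$ and this $3$-form is closed (where $d^c_\pm=I_\pm^{-1}\,d\,I_\pm$). Moreover, suppose the coframe descends to a smooth coframe on $M_f$, in the sense that $a_1,b_2,b_3$ extend to smooth functions on $\mathbb R$ whose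 associated forms satisfy $\rho^*(e^i(t+1))=e^i(t)$ for all $t\in\mathbb R$ and $i=1,2,3$. Then this structure can be taken to be the explicit one given, on $\mathbb T^3\times N\times[0,1]$ and with $\theta=dt$, $\frac{\partial}{\partial\theta}=\frac{\partial}{\partial t}$, by $$g=\sum_{i=1}^3(e^i)^2+k+\theta^2,\qquad I_\pm e_1=\tfrac{\partial}{\partial\theta},\quad I_\pm e_2=\pm e_3,\quad I_\pm e_3=\mp e_2,\quad I_\pm=J\ \text{ on } TN .$$ -/

import Mathlib

open Set Filter Topology
open scoped Manifold ContDiff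

section
variable {E H M M' : Type*} [NormedAddCommGroup E] [NormedSpace ℝ E] [TopologicalSpace H]
  {I : ModelWithCorners ℝ E H} [TopologicalSpace M] [TopologicalSpace M'] [ChartedSpace H M] [IsManifold I ∞ M]

theorem isManifold_of_deck {q : M → M'} (hq : IsLocalHomeomorph q) (hs : Function.Surjective q)
    (deck : ∀ a b : M, q a = q b →
      ∃ φ : M → M, ContMDiff I I ∞ φ ∧ (∀ z, q (φ z) = q z) ∧ φ a = b) :
    @IsManifold ℝ _ E _ _ H _ I ∞ M' _ (hq.chartedSpace hs) := by
  let _ := hq.chartedSpace (H := H) hs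
  apply isManifold_of_contDiffOn
  rintro e e' ⟨x, rfl⟩ ⟨x', rfl⟩
  generalize hs.hasRightInverse.choose x = a
  generalize hs.hasRightInverse.choose x' = b
  rintro y ⟨hy, hyr⟩
  simp only [mfld_simps, mem_preimage] at hy
  obtain ⟨⟨hy1, hy2⟩, hy3, hy4⟩ := hy
  rw [IsLocalHomeomorph.localInverseAt_symm] at hy3 hy4
  set z : M := (chartAt H a).symm (I.symm y) with hz
  set w : M := hq.localInverseAt b (q z) with hw
  have hwt : w ∈ (hq.localInverseAt (x := b)).target := (hq.localInverseAt b).map_source hy3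
  have hqw : q z = q w := (hq.apply_localInverseAt_of_mem hy3).symm
  obtain ⟨φ, hφ, hφq, hφz⟩ := deck z w hqw
  have hza : z ∈ (chartAt H a).source := (chartAt H a).map_target hy1
  have key : ContDiffWithinAt ℝ ∞ (extChartAt I b ∘ φ ∘ (extChartAt I a).symm) (range I)
      (extChartAt I a z) :=
    ((contMDiffAt_iff_of_mem_source hza (by rw [hφz]; exact hy4)).1 (hφ z)).2
  have hyz : extChartAt I a z = y := by
    simp [hz, (chartAt H a).right_inv hy1, I.right_inv hyr]
  rw [hyz] at key
  refine ContDiffWithinAt.congr_of_eventuallyEq (key.mono inter_subset_right) ?_ ?_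
  · have hc : ContinuousAt (fun y => φ ((chartAt H a).symm (I.symm y))) y := by
      refine hφ.continuous.continuousAt.comp ?_
      exact ((chartAt H a).continuousAt_symm hy1).comp I.continuous_symm.continuousAt
    have hc' : ContinuousAt (fun y => (chartAt H a).symm (I.symm y)) y :=
      ((chartAt H a).continuousAt_symm hy1).comp I.continuous_symm.continuousAt
    have h1 := hc.eventually_mem ((hq.localInverseAt (x := b)).open_target.mem_nhds
      (by simpa [← hz, hφz] using hwt))
    have h2 := (hq.continuous.continuousAt.comp hc').eventually_mem
      ((hq.localInverseAt (x := b)).open_source.mem_nhds (by simpa [← hz] using hy3))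
    filter_upwards [mem_nhdsWithin_of_mem_nhds h1, mem_nhdsWithin_of_mem_nhds h2] with u hu1 hu2
    simp only [mfld_simps, IsLocalHomeomorph.localInverseAt_symm]
    congr 2
    apply hq.injOn_localInverseAt_target ((hq.localInverseAt b).map_source hu2) hu1
    rw [hφq]
    exact hq.apply_localInverseAt_of_mem hu2
  · simp only [mfld_simps, IsLocalHomeomorph.localInverseAt_symm]
    rw [← hz, hφz]
end

/-- Euclidean `3`-space, the universal cover of the torus. -/
abbrev R3 : Type := EuclideanSpace ℝ (Fin 3)

/-- The torus `Γ \ ℝ³`: the orbit space of the lattice `Γ` acting on `ℝ³` by translations. -/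
def Torus (Γ : Submodule ℤ R3) : Type :=
  AddAction.orbitRel.Quotient Γ.toAddSubgroup R3

namespace Torus
variable (Γ : Submodule ℤ R3)

instance : TopologicalSpace (Torus Γ) :=
  inferInstanceAs (TopologicalSpace (AddAction.orbitRel.Quotient Γ.toAddSubgroup R3))

/-- The covering projection `ℝ³ → Γ \ ℝ³`. -/
def proj (v : R3) : Torus Γ := Quotient.mk _ v

theorem proj_surjective : Function.Surjective (proj Γ) := Quotient.mk_surjective

variable [DiscreteTopology Γ]

instance : ProperlyDiscontinuousVAdd Γ.toAddSubgroup R3 :=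
  haveI : DiscreteTopology Γ.toAddSubgroup := inferInstanceAs (DiscreteTopology Γ)
  AddSubgroup.properlyDiscontinuousVAdd_of_tendsto_cofinite _
    (AddSubgroup.tendsto_coe_cofinite_of_discrete _ (SetLike.isDiscrete_iff_discreteTopology.2 this))

instance : T2Space (Torus Γ) :=
  inferInstanceAs (T2Space (Quotient (AddAction.orbitRel Γ.toAddSubgroup R3)))

theorem isLocalHomeomorph_proj : IsLocalHomeomorph (proj Γ) :=
  (isAddQuotientCoveringMap_quotientMk_of_properlyDiscontinuousVAdd
    (E := R3) (G := Γ.toAddSubgroup)).isCoveringMap.isLocalHomeomorph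

/-- The charts of the torus are the local inverses of the covering projection. -/
noncomputable instance : ChartedSpace R3 (Torus Γ) :=
  (isLocalHomeomorph_proj Γ).chartedSpace (proj_surjective Γ)

instance : IsManifold 𝓘(ℝ, R3) ∞ (Torus Γ) := by
  refine isManifold_of_deck (isLocalHomeomorph_proj Γ) (proj_surjective Γ) fun a b hab => ?_
  obtain ⟨g, hg⟩ : ∃ g : Γ.toAddSubgroup, g +ᵥ b = a := Quotient.exact hab
  refine ⟨fun z => ((-g : Γ.toAddSubgroup) : R3) + z, ?_, fun z => ?_, ?_⟩
  · exact (contDiff_const.add contDiff_id).contMDiff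
  · exact Quotient.sound ⟨-g, rfl⟩
  · rw [← hg]
    simp [AddSubgroup.vadd_def]

instance : LocallyCompactSpace (Torus Γ) :=
  Manifold.locallyCompact_of_finiteDimensional 𝓘(ℝ, R3)

end Torus

section MappingTorus

variable {E H M : Type*} [NormedAddCommGroup E] [NormedSpace ℝ E] [TopologicalSpace H]
  {I : ModelWithCorners ℝ E H} [TopologicalSpace M] [ChartedSpace H M]

/-- The product `M × ℝ`, as a type carrying the `ℤ`-action determined by `f`. -/
def SuspensionCover (_f : M ≃ₘ⟮I, I⟯ M) : Type _ := M × ℝ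

namespace SuspensionCover
variable (f : M ≃ₘ⟮I, I⟯ M)

instance : TopologicalSpace (SuspensionCover f) := inferInstanceAs (TopologicalSpace (M × ℝ))

/-- The action `n · (x, t) = (fⁿ x, t + n)` of `ℤ` on `M × ℝ`. -/
instance : AddAction ℤ (SuspensionCover f) where
  vadd n y := (((f.toEquiv : Equiv.Perm M) ^ n) y.1, y.2 + n)
  zero_vadd y := by
    change ((((f.toEquiv : Equiv.Perm M) ^ (0 : ℤ)) y.1, y.2 + ((0 : ℤ) : ℝ)) : M × ℝ) = y
    simp only [zpow_zero, Equiv.Perm.coe_one, id_eq, Int.cast_zero, add_zero]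
    rfl
  add_vadd m n y := by
    change ((((f.toEquiv : Equiv.Perm M) ^ (m + n)) y.1, y.2 + ((m + n : ℤ) : ℝ)) : M × ℝ) =
      (((f.toEquiv : Equiv.Perm M) ^ m) (((f.toEquiv : Equiv.Perm M) ^ n) y.1), y.2 + n + m)
    rw [zpow_add, Equiv.Perm.mul_apply]
    push_cast
    ring_nf

theorem vadd_eq (n : ℤ) (y : SuspensionCover f) :
    n +ᵥ y = (((f.toEquiv : Equiv.Perm M) ^ n) y.1, y.2 + n) := rfl

theorem contMDiff_zpow (n : ℤ) : ContMDiff I I ∞ ((f.toEquiv : Equiv.Perm M) ^ n : Equiv.Perm M) := by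
  have hp : ∀ k : ℕ, ContMDiff I I ∞ ((f.toEquiv : Equiv.Perm M) ^ k : Equiv.Perm M) := by
    intro k
    induction k with
    | zero => exact contMDiff_id
    | succ k ih => rw [pow_succ]; exact ih.comp f.contMDiff
  have hm : ∀ k : ℕ, ContMDiff I I ∞ (((f.toEquiv : Equiv.Perm M) ^ k)⁻¹ : Equiv.Perm M) := by
    intro k
    induction k with
    | zero => exact contMDiff_id
    | succ k ih => rw [pow_succ', mul_inv_rev]; exact ih.comp f.symm.contMDiff
  cases n with
  | ofNat k => simpa using hp k
  | negSucc k => simpa [zpow_negSucc] using hm (k + 1)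

theorem contMDiff_vadd (n : ℤ) : ContMDiff (I.prod 𝓘(ℝ, ℝ)) (I.prod 𝓘(ℝ, ℝ)) ∞
    (fun y : M × ℝ => (((f.toEquiv : Equiv.Perm M) ^ n) y.1, y.2 + n)) :=
  ((contMDiff_zpow f n).comp contMDiff_fst).prodMk
    ((contDiff_id.add contDiff_const).contMDiff.comp contMDiff_snd)

instance : ContinuousConstVAdd ℤ (SuspensionCover f) :=
  ⟨fun n => (contMDiff_vadd f n).continuous⟩

instance : IsCancelVAdd ℤ (SuspensionCover f) where
  left_cancel' n _ _ h := by simpa using congrArg (fun y => (-n) +ᵥ y) h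
  right_cancel' m n y h := by
    have h2 : y.2 + (m : ℝ) = y.2 + n := congrArg Prod.snd h
    exact_mod_cast add_left_cancel h2

instance : ProperlyDiscontinuousVAdd ℤ (SuspensionCover f) where
  finite_disjoint_inter_image := by
    intro K L hK hL
    have hs : Continuous (fun y : SuspensionCover f => (y.2 : ℝ)) := continuous_snd
    obtain ⟨a, ha⟩ := (hK.image hs).isBounded.exists_norm_le
    obtain ⟨b, hb⟩ := (hL.image hs).isBounded.exists_norm_le
    refine (Set.finite_Icc (-⌈a + b⌉) ⌈a + b⌉).subset ?_
    rintro n ⟨_, ⟨y, hy, rfl⟩, hL'⟩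
    have h1 : |y.2| ≤ a := ha _ ⟨y, hy, rfl⟩
    have h2 : |y.2 + n| ≤ b := hb _ ⟨_, hL', rfl⟩
    have h3 : |(n : ℝ)| ≤ a + b := by
      have := abs_sub (y.2 + n) y.2
      rw [add_sub_cancel_left] at this
      linarith
    have h4 := h3.trans (Int.le_ceil (a + b))
    rw [abs_le] at h4
    exact ⟨by exact_mod_cast h4.1, by exact_mod_cast h4.2⟩

instance [T2Space M] : T2Space (SuspensionCover f) := inferInstanceAs (T2Space (M × ℝ))

instance [LocallyCompactSpace M] : LocallyCompactSpace (SuspensionCover f) :=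
  inferInstanceAs (LocallyCompactSpace (M × ℝ))

end SuspensionCover

/-- The mapping torus `M_f` of a diffeomorphism `f`: the quotient of `M × ℝ` by the `ℤ`-action
`n · (x, t) = (fⁿ x, t + n)`, that is, `M × [0, 1]` with `(x, 0)` glued to `(f x, 1)`. -/
def MappingTorus (f : M ≃ₘ⟮I, I⟯ M) : Type _ :=
  AddAction.orbitRel.Quotient ℤ (SuspensionCover f)

namespace MappingTorus
variable (f : M ≃ₘ⟮I, I⟯ M)

instance : TopologicalSpace (MappingTorus f) :=
  inferInstanceAs (TopologicalSpace (AddAction.orbitRel.Quotient ℤ (SuspensionCover f)))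

/-- The quotient map `(x, t) ↦ [(x, t)]`. -/
def mk (y : M × ℝ) : MappingTorus f :=
  Quotient.mk (AddAction.orbitRel ℤ (SuspensionCover f)) y

theorem mk_surjective : Function.Surjective (mk f) := Quotient.mk_surjective

theorem mk_glue (x : M) : mk f (x, 0) = mk f (f x, 1) :=
  Quotient.sound ⟨-1, by
    change (((f.toEquiv : Equiv.Perm M) ^ (-1 : ℤ)) (f x), (1 : ℝ) + ((-1 : ℤ) : ℝ)) = (x, (0 : ℝ))
    simp⟩

variable [T2Space M] [LocallyCompactSpace M]

instance : T2Space (MappingTorus f) :=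
  inferInstanceAs (T2Space (Quotient (AddAction.orbitRel ℤ (SuspensionCover f))))

theorem isLocalHomeomorph_mk : IsLocalHomeomorph (mk f) :=
  (isAddQuotientCoveringMap_quotientMk_of_properlyDiscontinuousVAdd
    (E := SuspensionCover f) (G := ℤ)).isCoveringMap.isLocalHomeomorph

/-- The charts of the mapping torus are local inverses of the quotient map followed by charts
of `M × ℝ`. -/
noncomputable instance : ChartedSpace (ModelProd H ℝ) (MappingTorus f) :=
  (isLocalHomeomorph_mk f).chartedSpace (mk_surjective f)

instance [IsManifold I ∞ M] : IsManifold (I.prod 𝓘(ℝ, ℝ)) ∞ (MappingTorus f) := by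
  refine isManifold_of_deck (isLocalHomeomorph_mk f) (mk_surjective f) fun a b hab => ?_
  obtain ⟨n, hn⟩ : ∃ n : ℤ, @HVAdd.hVAdd ℤ (SuspensionCover f) (SuspensionCover f) _ n a = b := Quotient.exact hab.symm
  exact ⟨_, SuspensionCover.contMDiff_vadd f n, fun z => Quotient.sound ⟨n, rfl⟩, hn⟩

end MappingTorus
end MappingTorus

section Geometry

variable {E H : Type*} [NormedAddCommGroup E] [NormedSpace ℝ E] [TopologicalSpace H]

/-- A field of endomorphisms of the tangent spaces of `M`. -/
abbrev EndField (I : ModelWithCorners ℝ E H) (M : Type*) [TopologicalSpace M] [ChartedSpace H M] :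
    Type _ := (p : M) → TangentSpace I p →L[ℝ] TangentSpace I p

/-- A (not necessarily smooth) differential `n`-form on `M`. -/
abbrev DiffForm (I : ModelWithCorners ℝ E H) (M : Type*) [TopologicalSpace M] [ChartedSpace H M]
    (n : ℕ) : Type _ := (p : M) → TangentSpace I p [⋀^Fin n]→L[ℝ] ℝ

variable (I : ModelWithCorners ℝ E H) {M : Type*} [TopologicalSpace M] [ChartedSpace H M]

/-- The expression of a differential form in the preferred chart at `p`: its pullback under the
inverse of the chart. -/
noncomputable def DiffForm.inChart {n : ℕ} (α : DiffForm I M n) (p : M) : E → E [⋀^Fin n]→L[ℝ] ℝ :=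
  fun y => (α ((extChartAt I p).symm y)).compContinuousLinearMap
    ((mfderivWithin 𝓘(ℝ, E) I (extChartAt I p).symm (range I) y).comp
      (NormedSpace.fromTangentSpace (𝕜 := ℝ) y).symm.toContinuousLinearMap)

/-- The exterior derivative of a differential form on a manifold, computed in charts. -/
noncomputable def DiffForm.d {n : ℕ} (α : DiffForm I M n) : DiffForm I M (n + 1) :=
  fun p => (extDerivWithin (α.inChart I p) (range I) (extChartAt I p p)).compContinuousLinearMap
    (mvfderiv I (extChartAt I p) p)

/-- The action of a field of endomorphisms on forms, `(J α)(X₁, …, Xₙ) = α(J X₁, …, J Xₙ)`. -/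
noncomputable def DiffForm.act {n : ℕ} (J : EndField I M) (α : DiffForm I M n) : DiffForm I M n :=
  fun p => (α p).compContinuousLinearMap (J p)

/-- The real Dolbeault operator `d^c = J⁻¹ d J` of an almost complex structure `J`, where
`J⁻¹ = -J`. -/
noncomputable def DiffForm.dc {n : ℕ} (J : EndField I M) (α : DiffForm I M n) :
    DiffForm I M (n + 1) :=
  DiffForm.act I (fun p => -J p) (DiffForm.d I (DiffForm.act I J α))

/-- The Nijenhuis tensor `N_J(X, Y) = [JX, JY] - J([JX, Y] + [X, JY]) - [X, Y]` of vector fields. -/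
noncomputable def nijenhuis (J : EndField I M) (X Y : (p : M) → TangentSpace I p) (p : M) :
    TangentSpace I p :=
  VectorField.mlieBracket I (fun q => J q (X q)) (fun q => J q (Y q)) p
    - J p (VectorField.mlieBracket I (fun q => J q (X q)) Y p
        + VectorField.mlieBracket I X (fun q => J q (Y q)) p)
    - VectorField.mlieBracket I X Y p

variable (M) [IsManifold I ∞ M]

/-- A complex structure on a smooth manifold: a smooth almost complex structure whose Nijenhuis
tensor vanishes. -/
structure ComplexStructure where
  /-- The field of endomorphisms. -/
  J : EndField I M
  smooth : ContMDiff I (I.prod 𝓘(ℝ, E →L[ℝ] E)) ∞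
    (fun p => Bundle.TotalSpace.mk' (E →L[ℝ] E)
      (E := fun p : M => TangentSpace I p →L[ℝ] TangentSpace I p) p (J p))
  sq (p : M) (X : TangentSpace I p) : J p (J p X) = -X
  integrable (p : M) (X Y : (q : M) → TangentSpace I q)
    (hX : ContMDiffAt I I.tangent ∞ (fun q => (⟨q, X q⟩ : TangentBundle I M)) p)
    (hY : ContMDiffAt I I.tangent ∞ (fun q => (⟨q, Y q⟩ : TangentBundle I M)) p) :
    nijenhuis I J X Y p = 0

/-- A smooth Riemannian metric on a manifold. -/
abbrev RiemMetric : Type _ :=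
  Bundle.ContMDiffRiemannianMetric I ∞ E (fun p : M => TangentSpace I p)

variable {M}

/-- The metric `g` is compatible with `J` (Hermitian): `g(JX, JY) = g(X, Y)`. -/
def IsCompatible (J : ComplexStructure I M) (g : RiemMetric I M) : Prop :=
  ∀ (p : M) (X Y : TangentSpace I p), g.inner p (J.J p X) (J.J p Y) = g.inner p X Y

theorem IsCompatible.apply_self {J : ComplexStructure I M} {g : RiemMetric I M}
    (h : IsCompatible I J g) (p : M) (X : TangentSpace I p) : g.inner p (J.J p X) X = 0 := by
  have h1 := h p (J.J p X) X
  rw [J.sq, map_neg, neg_apply, g.symm] at h1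
  linarith

/-- The fundamental form `ω(X, Y) = g(JX, Y)`, so that `g(X, Y) = ω(X, JY)`. -/
noncomputable def fundamentalForm {J : ComplexStructure I M} {g : RiemMetric I M}
    (h : IsCompatible I J g) : DiffForm I M 2 := fun p =>
  { toFun := fun v => g.inner p (J.J p (v 0)) (v 1)
    map_update_add' := by
      intro _ v i x y
      fin_cases i <;> simp
    map_update_smul' := by
      intro _ v i c x
      fin_cases i <;> simp
    cont := by
      have := (g.inner p).continuous
      fun_prop
    map_eq_zero_of_eq' := by
      intro v i j hij hne
      have h01 : v 0 = v 1 := by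
        fin_cases i <;> fin_cases j <;> simp_all
      rw [h01]
      exact h.apply_self I p (v 1) }

variable (M)

/-- A Kähler structure `(J, k, ω)` on a manifold. -/
structure KahlerStructure where
  /-- The complex structure. -/
  cpx : ComplexStructure I M
  /-- The Kähler metric. -/
  metric : RiemMetric I M
  compat : IsCompatible I cpx metric
  closed : DiffForm.d I (fundamentalForm I compat) = 0

/-- A generalized Kähler structure `(I₊, I₋, g)`: a Riemannian metric compatible with two complex
structures such that `d^c₊ ω₊ = - d^c₋ ω₋` is a closed `3`-form. -/
structure GenKahlerStructure where
  /-- The complex structure `I₊`. -/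
  cpxPlus : ComplexStructure I M
  /-- The complex structure `I₋`. -/
  cpxMinus : ComplexStructure I M
  /-- The Riemannian metric. -/
  metric : RiemMetric I M
  compatPlus : IsCompatible I cpxPlus metric
  compatMinus : IsCompatible I cpxMinus metric
  dc_eq : DiffForm.dc I cpxPlus.J (fundamentalForm I compatPlus)
    = -DiffForm.dc I cpxMinus.J (fundamentalForm I compatMinus)
  closed : DiffForm.d I (DiffForm.dc I cpxPlus.J (fundamentalForm I compatPlus)) = 0

variable {I M}

/-- A generalized Kähler structure is split if `I₊` and `I₋` commute. -/
def GenKahlerStructure.IsSplit (S : GenKahlerStructure I M) : Prop :=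
  ∀ (p : M) (X : TangentSpace I p),
    S.cpxPlus.J p (S.cpxMinus.J p X) = S.cpxMinus.J p (S.cpxPlus.J p X)

/-- A diffeomorphism preserves a Kähler structure if it is holomorphic and preserves the Kähler
form. -/
def KahlerStructure.IsPreservedBy (K : KahlerStructure I M) (ψ : M ≃ₘ⟮I, I⟯ M) : Prop :=
  (∀ (p : M) (X : TangentSpace I p),
      mfderiv I I ψ p (K.cpx.J p X) = K.cpx.J (ψ p) (mfderiv I I ψ p X)) ∧
    ∀ p : M, (fundamentalForm I K.compat (ψ p)).compContinuousLinearMap (mfderiv I I ψ p)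
      = fundamentalForm I K.compat p

end Geometry

namespace Torus
variable (Γ : Submodule ℤ R3) [DiscreteTopology Γ]

/-- The coordinate form `dx^i` on the torus, where `x¹, x², x³` are the local coordinates given by
the local inverses of `ℝ³ → Γ \ ℝ³`. -/
noncomputable def dx (i : Fin 3) (x : Torus Γ) : TangentSpace 𝓘(ℝ, R3) x →L[ℝ] ℝ :=
  mvfderiv 𝓘(ℝ, R3) (fun y : Torus Γ => (extChartAt 𝓘(ℝ, R3) x y : R3) i) x

/-- The coordinate vector field `∂/∂x^i` on the torus. -/
noncomputable def dd (i : Fin 3) (x : Torus Γ) : TangentSpace 𝓘(ℝ, R3) x :=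
  (mfderiv 𝓘(ℝ, R3) 𝓘(ℝ, R3) (extChartAt 𝓘(ℝ, R3) x) x).inverse
    ((NormedSpace.fromTangentSpace (𝕜 := ℝ) _).symm (EuclideanSpace.single i (1 : ℝ)))

end Torus

/-- The coefficient functions `a₁, b₂, b₃` of a time-dependent frame of the torus, together with
the derived quantities; only their values on `[0, 1]` matter. -/
structure FrameCoeffs where
  /-- The coefficient `a₁`. -/
  a₁ : ℝ → ℝ
  /-- The coefficient `b₂`. -/
  b₂ : ℝ → ℝ
  /-- The coefficient `b₃`. -/
  b₃ : ℝ → ℝ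

namespace FrameCoeffs
variable (c : FrameCoeffs)

/-- `l = b₂² + b₃²`. -/
def l (t : ℝ) : ℝ := c.b₂ t ^ 2 + c.b₃ t ^ 2

/-- `v = b₂ b₂' + b₃ b₃'`, with derivatives on `[0, 1]` (one-sided at the end points). -/
noncomputable def v (t : ℝ) : ℝ :=
  c.b₂ t * derivWithin c.b₂ (Icc 0 1) t + c.b₃ t * derivWithin c.b₃ (Icc 0 1) t

/-- `w = b₂ b₃' - b₃ b₂'`, with derivatives on `[0, 1]` (one-sided at the end points). -/
noncomputable def w (t : ℝ) : ℝ :=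
  c.b₂ t * derivWithin c.b₃ (Icc 0 1) t - c.b₃ t * derivWithin c.b₂ (Icc 0 1) t

/-- The standing assumptions on the coefficients: they are smooth on `[0, 1]`, the vector fields
`e₁(t), e₂(t), e₃(t)` form a frame for every `t`, and `v / l`, `w / l` take the same values at
`0` and `1`. -/
structure IsAdmissible : Prop where
  smooth_a₁ : ContDiffOn ℝ ∞ c.a₁ (Icc 0 1)
  smooth_b₂ : ContDiffOn ℝ ∞ c.b₂ (Icc 0 1)
  smooth_b₃ : ContDiffOn ℝ ∞ c.b₃ (Icc 0 1)
  a₁_ne_zero : ∀ t ∈ Icc (0 : ℝ) 1, c.a₁ t ≠ 0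
  l_pos : ∀ t ∈ Icc (0 : ℝ) 1, 0 < c.l t
  v_eq : c.v 1 / c.l 1 = c.v 0 / c.l 0
  w_eq : c.w 1 / c.l 1 = c.w 0 / c.l 0

variable (Γ : Submodule ℤ R3) [DiscreteTopology Γ]

/-- The frame `e₁ = a₁ ∂₁`, `e₂ = b₂ ∂₂ + b₃ ∂₃`, `e₃ = -b₃ ∂₂ + b₂ ∂₃` of the torus at time `t`. -/
noncomputable def frame (t : ℝ) (x : Torus Γ) : Fin 3 → TangentSpace 𝓘(ℝ, R3) x :=
  ![c.a₁ t • Torus.dd Γ 0 x,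
    c.b₂ t • Torus.dd Γ 1 x + c.b₃ t • Torus.dd Γ 2 x,
    -c.b₃ t • Torus.dd Γ 1 x + c.b₂ t • Torus.dd Γ 2 x]

/-- The dual coframe `e¹ = (1/a₁) dx¹`, `e² = (b₂/l) dx² + (b₃/l) dx³`,
`e³ = -(b₃/l) dx² + (b₂/l) dx³` of the torus at time `t`. -/
noncomputable def coframe (t : ℝ) (x : Torus Γ) : Fin 3 → (TangentSpace 𝓘(ℝ, R3) x →L[ℝ] ℝ) :=
  ![(1 / c.a₁ t) • Torus.dx Γ 0 x,
    (c.b₂ t / c.l t) • Torus.dx Γ 1 x + (c.b₃ t / c.l t) • Torus.dx Γ 2 x,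
    -(c.b₃ t / c.l t) • Torus.dx Γ 1 x + (c.b₂ t / c.l t) • Torus.dx Γ 2 x]

/-- `ρ^*(e^i(t)) = e^i(s)` for `i = 1, 2, 3`. -/
def PullsBack (ρ : Torus Γ ≃ₘ⟮𝓘(ℝ, R3), 𝓘(ℝ, R3)⟯ Torus Γ) (t s : ℝ) : Prop :=
  ∀ (i : Fin 3) (x : Torus Γ),
    (c.coframe Γ t (ρ x) i).comp (mfderiv 𝓘(ℝ, R3) 𝓘(ℝ, R3) ρ x) = c.coframe Γ s x i

/-- The coframe glues to a smooth coframe on the mapping torus: it is the restriction to `[0, 1]` of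
a smooth family, indexed by `t ∈ ℝ`, that is invariant under `(x, t) ↦ (ρ x, t + 1)`. -/
def GluesSmoothly (ρ : Torus Γ ≃ₘ⟮𝓘(ℝ, R3), 𝓘(ℝ, R3)⟯ Torus Γ) : Prop :=
  ∃ c' : FrameCoeffs, ContDiff ℝ ∞ c'.a₁ ∧ ContDiff ℝ ∞ c'.b₂ ∧ ContDiff ℝ ∞ c'.b₃ ∧
    (∀ t ∈ Icc (0 : ℝ) 1, c'.a₁ t = c.a₁ t ∧ c'.b₂ t = c.b₂ t ∧ c'.b₃ t = c.b₃ t) ∧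
    ∀ t : ℝ, c'.PullsBack Γ ρ (t + 1) t

end FrameCoeffs

section Explicit

variable {Γ : Submodule ℤ R3} [DiscreteTopology Γ]
  {E N : Type*} [NormedAddCommGroup E] [NormedSpace ℝ E] [TopologicalSpace N] [ChartedSpace E N]
  [IsManifold 𝓘(ℝ, E) ∞ N] [T2Space N] [LocallyCompactSpace N]

/-- The model with corners of `(Γ \ ℝ³) × N`. -/
noncomputable abbrev modelTN (E : Type*) [NormedAddCommGroup E] [NormedSpace ℝ E] :
    ModelWithCorners ℝ (R3 × E) (ModelProd R3 E) := 𝓘(ℝ, R3).prod 𝓘(ℝ, E)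

/-- The image `dq(X, ξ, s)` of a tangent vector `(X, ξ, s)` of `(Γ \ ℝ³) × N × ℝ` at `(x, p, t)`
under the differential of the quotient map `q` onto the mapping torus. -/
noncomputable def pushTangent (f : (Torus Γ × N) ≃ₘ⟮modelTN E, modelTN E⟯ (Torus Γ × N))
    (x : Torus Γ) (p : N) (t : ℝ) (X : TangentSpace 𝓘(ℝ, R3) x) (ξ : TangentSpace 𝓘(ℝ, E) p)
    (s : ℝ) : TangentSpace ((modelTN E).prod 𝓘(ℝ, ℝ)) (MappingTorus.mk f ((x, p), t)) :=
  mfderiv ((modelTN E).prod 𝓘(ℝ, ℝ)) ((modelTN E).prod 𝓘(ℝ, ℝ)) (MappingTorus.mk f) ((x, p), t)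
    (((X, ξ), s) : (R3 × E) × ℝ)

/-- The generalized Kähler structure `(I₊, I₋, g)` on the mapping torus is the explicit one built
from the frame `e_i(t)`, the Kähler structure `(J, k)` and `∂/∂θ = ∂/∂t`:
`g = ∑ (e^i)² + k + θ²`, `I_± e₁ = ∂/∂θ`, `I_± e₂ = ± e₃`, `I_± e₃ = ∓ e₂`, and `I_± = J` on the
directions tangent to `N`. -/
structure IsExplicit (c : FrameCoeffs) (K : KahlerStructure 𝓘(ℝ, E) N)
    (f : (Torus Γ × N) ≃ₘ⟮modelTN E, modelTN E⟯ (Torus Γ × N))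
    (S : GenKahlerStructure ((modelTN E).prod 𝓘(ℝ, ℝ)) (MappingTorus f)) : Prop where
  metric_eq : ∀ (x : Torus Γ) (p : N), ∀ t ∈ Icc (0 : ℝ) 1,
    ∀ (X Y : TangentSpace 𝓘(ℝ, R3) x) (ξ ζ : TangentSpace 𝓘(ℝ, E) p) (r s : ℝ),
      S.metric.inner (MappingTorus.mk f ((x, p), t)) (pushTangent f x p t X ξ r)
          (pushTangent f x p t Y ζ s)
        = ∑ i, c.coframe Γ t x i X * c.coframe Γ t x i Y + K.metric.inner p ξ ζ + r * s
  plus_e₁ : ∀ (x : Torus Γ) (p : N), ∀ t ∈ Icc (0 : ℝ) 1,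
    S.cpxPlus.J (MappingTorus.mk f ((x, p), t)) (pushTangent f x p t (c.frame Γ t x 0) 0 0)
      = pushTangent f x p t 0 0 1
  plus_e₂ : ∀ (x : Torus Γ) (p : N), ∀ t ∈ Icc (0 : ℝ) 1,
    S.cpxPlus.J (MappingTorus.mk f ((x, p), t)) (pushTangent f x p t (c.frame Γ t x 1) 0 0)
      = pushTangent f x p t (c.frame Γ t x 2) 0 0
  plus_e₃ : ∀ (x : Torus Γ) (p : N), ∀ t ∈ Icc (0 : ℝ) 1,
    S.cpxPlus.J (MappingTorus.mk f ((x, p), t)) (pushTangent f x p t (c.frame Γ t x 2) 0 0)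
      = -pushTangent f x p t (c.frame Γ t x 1) 0 0
  plus_N : ∀ (x : Torus Γ) (p : N), ∀ t ∈ Icc (0 : ℝ) 1, ∀ ξ : TangentSpace 𝓘(ℝ, E) p,
    S.cpxPlus.J (MappingTorus.mk f ((x, p), t)) (pushTangent f x p t 0 ξ 0)
      = pushTangent f x p t 0 (K.cpx.J p ξ) 0
  minus_e₁ : ∀ (x : Torus Γ) (p : N), ∀ t ∈ Icc (0 : ℝ) 1,
    S.cpxMinus.J (MappingTorus.mk f ((x, p), t)) (pushTangent f x p t (c.frame Γ t x 0) 0 0)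
      = pushTangent f x p t 0 0 1
  minus_e₂ : ∀ (x : Torus Γ) (p : N), ∀ t ∈ Icc (0 : ℝ) 1,
    S.cpxMinus.J (MappingTorus.mk f ((x, p), t)) (pushTangent f x p t (c.frame Γ t x 1) 0 0)
      = -pushTangent f x p t (c.frame Γ t x 2) 0 0
  minus_e₃ : ∀ (x : Torus Γ) (p : N), ∀ t ∈ Icc (0 : ℝ) 1,
    S.cpxMinus.J (MappingTorus.mk f ((x, p), t)) (pushTangent f x p t (c.frame Γ t x 2) 0 0)
      = pushTangent f x p t (c.frame Γ t x 1) 0 0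
  minus_N : ∀ (x : Torus Γ) (p : N), ∀ t ∈ Icc (0 : ℝ) 1, ∀ ξ : TangentSpace 𝓘(ℝ, E) p,
    S.cpxMinus.J (MappingTorus.mk f ((x, p), t)) (pushTangent f x p t 0 ξ 0)
      = pushTangent f x p t 0 (K.cpx.J p ξ) 0

end Explicit

/-! On the cover `Torus Γ × N × ℝ` the candidate structures depend on the frame only through two
functions `a`, `l` of `t`, because `(e²)² + (e³)² = l⁻¹((dx²)² + (dx³)²)` and the rotation `e₂ ↦
e₃`, `e₃ ↦ -e₂` is the standard one, `∂₂ ↦ ∂₃`, `∂₃ ↦ -∂₂`. Thus `g = a⁻²(dx¹)² + l⁻¹((dx²)² +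
(dx³)²) + k + dt²`, and the fundamental forms are `ω_± = a⁻¹ dx¹ ∧ dt ± l⁻¹ dx² ∧ dx³ + ω`. Both
structures are integrable: the `(x¹, t)` part is an almost complex structure in two dimensions, the
`(x², x³)` part is constant, and the rest is `J`. Since `ω` is closed, `dω_± = ±(l⁻¹)' dt ∧ dx² ∧
dx³`; if `(l⁻¹)' = C a`, then `d^c_± ω_± = ∓C dx¹ ∧ dx² ∧ dx³`, which is closed and changes sign
with `±`.

The structure descends if the deck transformation preserves it. The differential of `ρ` has constant
matrix: a scaling `r` of `x¹` and a similarity `α + iβ` of the `(x², x³)` plane. Invariance amounts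
to `a(t+1) = r a(t)`, `l(t+1) = (α² + β²) l(t)` and `r(α² + β²) = 1`, the last relation also making
`ρ` preserve volume. These conditions form `IsInvariantFamily`; `deckDeriv_intertwines` and
`dmk_intertwines` carry out the descent, and `nijenhuisTensor_cplx`, `d_fundamentalForm_apply` and
`d_dc_fundamentalForm` verify the equations.

It remains to find `a` and `l`. If the coframe glues smoothly, `a₁` and `l` themselves work
(`isInvariantFamily_of_forall_pullsBack`), and the structure is the explicit one. In general only
the values at `0` and `1` are used: `v/l` agreeing there, together with `(1/l)'/a₁` constant, forces
`a₁ l` to agree there, and exponentials with these end values form an invariant family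
(`exists_isInvariantFamily`). -/

set_option maxSynthPendingDepth 3

/-! ### Tensor fields and their smoothness, read in preferred charts -/

section ChartReadings

variable {E H : Type*} [NormedAddCommGroup E] [NormedSpace ℝ E] [TopologicalSpace H]
  (I : ModelWithCorners ℝ E H) {M : Type*} [TopologicalSpace M] [ChartedSpace H M]

/-- The derivative of the inverse of the preferred chart at `p`, as an endomorphism of the model
space. -/
noncomputable def symmDeriv (p : M) (u : E) : E →L[ℝ] E :=
  mfderivWithin 𝓘(ℝ, E) I (extChartAt I p).symm (range I) u

/-- The derivative at `q` of the preferred chart at `p`, as an endomorphism of the model space. -/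
noncomputable def chartDeriv (p q : M) : E →L[ℝ] E :=
  mfderiv I 𝓘(ℝ, E) (extChartAt I p) q

/-- A field of endomorphisms read in the preferred chart at `p`. -/
noncomputable def EndField.inChart (J : EndField I M) (p : M) (u : E) : E →L[ℝ] E :=
  (chartDeriv I p ((extChartAt I p).symm u)).comp
    ((show E →L[ℝ] E from J ((extChartAt I p).symm u)).comp (symmDeriv I p u))

/-- A field of bilinear forms on the tangent spaces read in the preferred chart at `p`. -/
noncomputable def bilinInChart (g : (p : M) → TangentSpace I p →L[ℝ] TangentSpace I p →L[ℝ] ℝ)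
    (p : M) (u : E) : E →L[ℝ] E →L[ℝ] ℝ :=
  (show E →L[ℝ] E →L[ℝ] ℝ from g ((extChartAt I p).symm u)).bilinearComp
    (symmDeriv I p u) (symmDeriv I p u)

variable {I} [IsManifold I ∞ M]

theorem chartDeriv_comp_symmDeriv {p : M} {u : E} (hu : u ∈ (extChartAt I p).target) :
    (chartDeriv I p ((extChartAt I p).symm u)).comp (symmDeriv I p u) = .id ℝ E :=
  haveI : IsManifold I 1 M := .of_le (n := ∞) (by simp)
  mfderiv_extChartAt_comp_mfderivWithin_extChartAt_symm hu

theorem symmDeriv_comp_chartDeriv {p : M} {u : E} (hu : u ∈ (extChartAt I p).target) :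
    (symmDeriv I p u).comp (chartDeriv I p ((extChartAt I p).symm u)) = .id ℝ E :=
  haveI : IsManifold I 1 M := .of_le (n := ∞) (by simp)
  mfderivWithin_extChartAt_symm_comp_mfderiv_extChartAt hu

theorem chartDeriv_self (p : M) : chartDeriv I p p = .id ℝ E :=
  haveI : IsManifold I 1 M := .of_le (n := ∞) (by simp)
  mfderiv_extChartAt_self

theorem symmDeriv_self (p : M) : symmDeriv I p (extChartAt I p p) = .id ℝ E :=
  haveI : IsManifold I 1 M := .of_le (n := ∞) (by simp)
  mfderivWithin_range_extChartAt_symm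

omit [IsManifold I ∞ M] in
theorem contMDiffAt_comp_extChartAt_iff [I.Boundaryless] {G : Type*} [NormedAddCommGroup G]
    [NormedSpace ℝ G] {F : E → G} {p : M} :
    ContMDiffAt I 𝓘(ℝ, G) ∞ (fun q => F (extChartAt I p q)) p ↔
      ContDiffAt ℝ ∞ F (extChartAt I p p) := by
  refine ⟨fun h => ?_, fun h => h.contMDiffAt.comp p contMDiffAt_extChartAt⟩
  have h3 := (contMDiffAt_iff.1 h).2
  simp only [I.range_eq_univ, contDiffWithinAt_univ] at h3
  refine h3.congr_of_eventuallyEq ?_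
  filter_upwards [(isOpen_extChartAt_target p).mem_nhds (mem_extChartAt_target p)] with u hu
  exact congrArg F ((extChartAt I p).right_inv hu).symm

/-- The tangent trivialization at `p` is the derivative of the preferred chart at `p`, so near `p`
the coordinates of the hom bundle coincide with the chart reading. Smoothness of `J` becomes
smoothness of a map between normed spaces. -/
theorem contMDiffAt_endField_iff [I.Boundaryless] (J : EndField I M) (p : M) :
    ContMDiffAt I (I.prod 𝓘(ℝ, E →L[ℝ] E)) ∞
      (fun q => Bundle.TotalSpace.mk' (E →L[ℝ] E)
        (E := fun q : M => TangentSpace I q →L[ℝ] TangentSpace I q) q (J q)) p ↔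
    ContDiffAt ℝ ∞ (J.inChart I p) (extChartAt I p p) := by
  have : IsManifold I 1 M := .of_le (n := ∞) (by simp)
  rw [contMDiffAt_hom_bundle]
  have h1 : (fun q => ContinuousLinearMap.inCoordinates E (fun q : M => TangentSpace I q) E
      (fun q : M => TangentSpace I q) p q p q (J q)) =ᶠ[𝓝 p]
      fun q => J.inChart I p (extChartAt I p q) := by
    filter_upwards [(chartAt H p).open_source.mem_nhds (mem_chart_source H p)] with q hq
    have hq' : q ∈ (extChartAt I p).source := by rwa [extChartAt_source]
    rw [ContinuousLinearMap.inCoordinates, TangentBundle.continuousLinearMapAt_trivializationAt hq,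
      TangentBundle.symmL_trivializationAt hq]
    simp only [EndField.inChart, chartDeriv, symmDeriv]
    rw [(extChartAt I p).left_inv hq']
    rfl
  constructor
  · rintro ⟨-, h⟩
    have h2 := h.congr_of_eventuallyEq h1.symm
    exact contMDiffAt_comp_extChartAt_iff.1 h2
  · intro h
    refine ⟨contMDiffAt_id, ContMDiffAt.congr_of_eventuallyEq ?_ h1⟩
    exact contMDiffAt_comp_extChartAt_iff.2 h

theorem contMDiffAt_bilin_iff [I.Boundaryless]
    (g : (p : M) → TangentSpace I p →L[ℝ] TangentSpace I p →L[ℝ] ℝ) (p : M) :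
    ContMDiffAt I (I.prod 𝓘(ℝ, E →L[ℝ] E →L[ℝ] ℝ)) ∞
      (fun q => Bundle.TotalSpace.mk' (E →L[ℝ] E →L[ℝ] ℝ)
        (E := fun q : M => TangentSpace I q →L[ℝ] TangentSpace I q →L[ℝ] ℝ) q (g q)) p ↔
    ContDiffAt ℝ ∞ (bilinInChart I g p) (extChartAt I p p) := by
  have : IsManifold I 1 M := .of_le (n := ∞) (by simp)
  rw [contMDiffAt_hom_bundle]
  have h1 : (fun q => ContinuousLinearMap.inCoordinates E (fun q : M => TangentSpace I q)
      (E →L[ℝ] ℝ) (fun q : M => TangentSpace I q →L[ℝ] ℝ) p q p q (g q)) =ᶠ[𝓝 p]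
      fun q => bilinInChart I g p (extChartAt I p q) := by
    filter_upwards [(chartAt H p).open_source.mem_nhds (mem_chart_source H p)] with q hq
    have hq' : q ∈ (extChartAt I p).source := by rwa [extChartAt_source]
    ext v w
    have key := inCoordinates_apply_eq₂ (F₁ := E) (F₂ := E) (F₃ := ℝ)
      (E₁ := fun q : M => TangentSpace I q) (E₂ := fun q : M => TangentSpace I q)
      (E₃ := Bundle.Trivial M ℝ) (x₀ := p) (x := q) (ϕ := g q) (v := v) (w := w)
      (by simpa using hq) (by simpa using hq) (by simp)
    refine key.trans ?_
    have h2 := TangentBundle.symmL_trivializationAt (I := I) hq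
    have h3 : ∀ v : E, (trivializationAt E (TangentSpace I) p).symm q v =
        symmDeriv I p (extChartAt I p q) v := fun v =>
      (Bundle.Trivialization.symmL_apply (R := ℝ) (trivializationAt E (TangentSpace I) p)
        (b := q) (by simpa using hq) v).symm.trans
        (congrArg (fun (L : E →L[ℝ] TangentSpace I q) => L v) h2)
    have h4 : ∀ r : ℝ, Bundle.Trivialization.linearMapAt ℝ
        (trivializationAt ℝ (Bundle.Trivial M ℝ) p) q r = r := fun r => by
      change Bundle.Trivialization.linearMapAt ℝ (Bundle.Trivial.trivialization M ℝ) q r = r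
      rw [Bundle.Trivial.linearMapAt_trivialization]
      rfl
    rw [h3, h3, bilinInChart, (extChartAt I p).left_inv hq']
    exact h4 _
  constructor
  · rintro ⟨-, h⟩
    have h2 := h.congr_of_eventuallyEq h1.symm
    exact contMDiffAt_comp_extChartAt_iff.1 h2
  · intro h
    refine ⟨contMDiffAt_id, ContMDiffAt.congr_of_eventuallyEq ?_ h1⟩
    exact contMDiffAt_comp_extChartAt_iff.2 h

end ChartReadings

/-! ### Lie brackets, integrability and exterior derivatives in charts -/

/-- The Nijenhuis tensor at `u` of a field `A` of endomorphisms of a vector space with `A ^ 2 = -1`,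
in terms of the derivative of `A`. -/
noncomputable def nijenhuisTensor {E : Type*} [NormedAddCommGroup E] [NormedSpace ℝ E]
    (A : E → E →L[ℝ] E) (u X Y : E) : E :=
  fderiv ℝ A u (A u X) Y - fderiv ℝ A u (A u Y) X - A u (fderiv ℝ A u X Y)
    + A u (fderiv ℝ A u Y X)

/-- By the product rule every derivative of `X` or `Y` occurs together with powers of `A`, and `A ^
2 = -1` at the point `u` cancels all of them. Only derivatives of `A` survive, so the expression is
tensorial. -/
theorem lieBracket_nijenhuis {E : Type*} [NormedAddCommGroup E] [NormedSpace ℝ E]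
    {A : E → E →L[ℝ] E} {u : E} {X Y : E → E} (hA : DifferentiableAt ℝ A u)
    (hX : DifferentiableAt ℝ X u) (hY : DifferentiableAt ℝ Y u) (hsq : ∀ v, A u (A u v) = -v) :
    VectorField.lieBracket ℝ (fun z => A z (X z)) (fun z => A z (Y z)) u
      - A u (VectorField.lieBracket ℝ (fun z => A z (X z)) Y u
        + VectorField.lieBracket ℝ X (fun z => A z (Y z)) u)
      - VectorField.lieBracket ℝ X Y u = nijenhuisTensor A u (X u) (Y u) := by
  have e1 : fderiv ℝ (fun z => A z (X z)) u = (A u).comp (fderiv ℝ X u) + (fderiv ℝ A u).flip (X u) :=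
    fderiv_clm_apply hA hX
  have e2 : fderiv ℝ (fun z => A z (Y z)) u = (A u).comp (fderiv ℝ Y u) + (fderiv ℝ A u).flip (Y u) :=
    fderiv_clm_apply hA hY
  simp only [VectorField.lieBracket, e1, e2, nijenhuisTensor, add_apply,
    ContinuousLinearMap.comp_apply, ContinuousLinearMap.flip_apply, map_add, map_sub, hsq]
  abel

section ChartTensors

variable {E H : Type*} [NormedAddCommGroup E] [NormedSpace ℝ E] [TopologicalSpace H]
  (I : ModelWithCorners ℝ E H) {M : Type*} [TopologicalSpace M] [ChartedSpace H M]

/-- A vector field read in the preferred chart at `p`. -/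
noncomputable def fieldInChart (X : (q : M) → TangentSpace I q) (p : M) (u : E) : E :=
  chartDeriv I p ((extChartAt I p).symm u) (X ((extChartAt I p).symm u))

variable {I} [IsManifold I ∞ M]

theorem fieldInChart_self (X : (q : M) → TangentSpace I q) (p : M) :
    fieldInChart I X p (extChartAt I p p) = X p := by
  rw [fieldInChart, extChartAt_to_inv, chartDeriv_self]
  rfl

theorem EndField.inChart_self (J : EndField I M) (p : M) :
    J.inChart I p (extChartAt I p p) = (show E →L[ℝ] E from J p) := by
  rw [EndField.inChart, extChartAt_to_inv, chartDeriv_self, symmDeriv_self]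
  rfl

theorem symmDeriv_inChart (J : EndField I M) {p : M} {u : E} (hu : u ∈ (extChartAt I p).target) :
    (symmDeriv I p u).comp (J.inChart I p u) =
      (show E →L[ℝ] E from J ((extChartAt I p).symm u)).comp (symmDeriv I p u) := by
  rw [EndField.inChart, ← ContinuousLinearMap.comp_assoc, symmDeriv_comp_chartDeriv hu,
    ContinuousLinearMap.id_comp]

theorem fieldInChart_apply (J : EndField I M) (X : (q : M) → TangentSpace I q)
    {p : M} {u : E} (hu : u ∈ (extChartAt I p).target) :
    fieldInChart I (fun q => J q (X q)) p u = J.inChart I p u (fieldInChart I X p u) := by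
  have h := congrArg (fun L : E →L[ℝ] E => L (X ((extChartAt I p).symm u)))
    (symmDeriv_comp_chartDeriv (I := I) hu)
  exact congrArg (fun v : E => chartDeriv I p ((extChartAt I p).symm u)
    ((show E →L[ℝ] E from J ((extChartAt I p).symm u)) v)) h.symm

theorem mpullbackWithin_eq_fieldInChart (X : (q : M) → TangentSpace I q) {p : M} {u : E}
    (hu : u ∈ (extChartAt I p).target) :
    VectorField.mpullbackWithin 𝓘(ℝ, E) I (extChartAt I p).symm X (range I) u =
      fieldInChart I X p u := by
  have h : (symmDeriv I p u).inverse = chartDeriv I p ((extChartAt I p).symm u) :=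
    ContinuousLinearMap.inverse_eq (symmDeriv_comp_chartDeriv hu) (chartDeriv_comp_symmDeriv hu)
  exact congrArg (fun L : E →L[ℝ] E => L (X ((extChartAt I p).symm u))) h

variable [I.Boundaryless]

omit [IsManifold I ∞ M] in
theorem eventually_mem_target (p : M) : ∀ᶠ u in 𝓝 (extChartAt I p p), u ∈ (extChartAt I p).target :=
  (isOpen_extChartAt_target p).mem_nhds (mem_extChartAt_target p)

/-- The derivative of the preferred chart at its own base point is the identity, so no correction is
left after pulling back to the chart. Replacing the fields by germs `X'`, `Y'` allows a product `J
X` to be substituted by its chart reading. -/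
theorem mlieBracket_eq_lieBracket (X Y : (q : M) → TangentSpace I q) (p : M) {X' Y' : E → E}
    (hX : fieldInChart I X p =ᶠ[𝓝 (extChartAt I p p)] X')
    (hY : fieldInChart I Y p =ᶠ[𝓝 (extChartAt I p p)] Y') :
    VectorField.mlieBracket I X Y p = VectorField.lieBracket ℝ X' Y' (extChartAt I p p) := by
  have h1 : (chartDeriv I p p).inverse = .id ℝ E := by
    rw [chartDeriv_self, ContinuousLinearMap.inverse_id]
  let P (Z : (q : M) → TangentSpace I q) : E → E :=
    VectorField.mpullbackWithin 𝓘(ℝ, E) I (extChartAt I p).symm Z (range I)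
  have h2 : (show E from VectorField.mlieBracket I X Y p) = (chartDeriv I p p).inverse
    (VectorField.lieBracketWithin ℝ (P X) (P Y) ((extChartAt I p).symm ⁻¹' univ ∩ range I)
      (extChartAt I p p)) := rfl
  refine h2.trans ?_
  rw [h1, ContinuousLinearMap.id_apply, preimage_univ, I.range_eq_univ, univ_inter,
    VectorField.lieBracketWithin_univ]
  apply Filter.EventuallyEq.lieBracket_vectorField_eq
  · filter_upwards [hX, eventually_mem_target p] with u h hu
    exact (mpullbackWithin_eq_fieldInChart X hu).trans h
  · filter_upwards [hY, eventually_mem_target p] with u h hu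
    exact (mpullbackWithin_eq_fieldInChart Y hu).trans h

theorem differentiableAt_fieldInChart [CompleteSpace E] (X : (q : M) → TangentSpace I q) (p : M)
    (hX : ContMDiffAt I I.tangent ∞ (fun q => (⟨q, X q⟩ : TangentBundle I M)) p) :
    DifferentiableAt ℝ (fieldInChart I X p) (extChartAt I p p) := by
  let P : E → E := VectorField.mpullbackWithin 𝓘(ℝ, E) I (extChartAt I p).symm X (range I)
  have h : DifferentiableWithinAt ℝ P ((extChartAt I p).symm ⁻¹' univ ∩ range I)
      (extChartAt I p p) :=
    (hX.mdifferentiableAt (by simp)).mdifferentiableWithinAt (s := univ)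
      |>.differentiableWithinAt_mpullbackWithin_vectorField
  rw [preimage_univ, univ_inter, I.range_eq_univ, differentiableWithinAt_univ] at h
  refine h.congr_of_eventuallyEq ?_
  filter_upwards [eventually_mem_target p] with u hu
  exact (mpullbackWithin_eq_fieldInChart X hu).symm

theorem nijenhuis_eq_nijenhuisTensor [CompleteSpace E] {J : EndField I M} {p : M}
    (hJ : DifferentiableAt ℝ (J.inChart I p) (extChartAt I p p))
    (hsq : ∀ v : TangentSpace I p, J p (J p v) = -v) {X Y : (q : M) → TangentSpace I q}
    (hX : ContMDiffAt I I.tangent ∞ (fun q => (⟨q, X q⟩ : TangentBundle I M)) p)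
    (hY : ContMDiffAt I I.tangent ∞ (fun q => (⟨q, Y q⟩ : TangentBundle I M)) p) :
    nijenhuis I J X Y p = nijenhuisTensor (J.inChart I p) (extChartAt I p p) (X p) (Y p) := by
  have hJX : ∀ Z : (q : M) → TangentSpace I q, fieldInChart I (fun q => J q (Z q)) p
      =ᶠ[𝓝 (extChartAt I p p)] fun u => J.inChart I p u (fieldInChart I Z p u) := fun Z => by
    filter_upwards [eventually_mem_target p] with u hu using fieldInChart_apply J Z hu
  rw [nijenhuis, mlieBracket_eq_lieBracket _ _ p (hJX X) (hJX Y),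
    mlieBracket_eq_lieBracket _ _ p (hJX X) .rfl, mlieBracket_eq_lieBracket _ _ p .rfl (hJX Y),
    mlieBracket_eq_lieBracket _ _ p .rfl .rfl]
  have := lieBracket_nijenhuis hJ (differentiableAt_fieldInChart X p hX)
    (differentiableAt_fieldInChart Y p hY) (fun v => by rw [EndField.inChart_self]; exact hsq v)
  rw [fieldInChart_self, fieldInChart_self] at this
  rw [← this, EndField.inChart_self]
  rfl

-- The extension is constant in the trivialization at `p`. It turns integrability, which is stated
-- for vector fields, into the vanishing of a tensor on arbitrary vectors.
omit [I.Boundaryless] in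
theorem exists_contMDiffAt_field (p : M) (v : TangentSpace I p) :
    ∃ X : (q : M) → TangentSpace I q,
      ContMDiffAt I I.tangent ∞ (fun q => (⟨q, X q⟩ : TangentBundle I M)) p ∧ X p = v := by
  have : IsManifold I 1 M := .of_le (n := ∞) (by simp)
  set e := trivializationAt E (TangentSpace I) p with he
  refine ⟨fun q => e.symm q (e ⟨p, v⟩).2, ?_, ?_⟩
  · refine (Bundle.contMDiffAt_section (F := E) p).2 (ContMDiffAt.congr_of_eventuallyEq
      (f := fun _ => (e ⟨p, v⟩).2) contMDiffAt_const ?_)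
    filter_upwards [e.open_baseSet.mem_nhds (FiberBundle.mem_baseSet_trivializationAt' p)] with q hq
    exact (congrArg Prod.snd (e.apply_mk_symm hq (e ⟨p, v⟩).2)).trans rfl
  · exact e.symm_apply_apply_mk (FiberBundle.mem_baseSet_trivializationAt' p) v

theorem ComplexStructure.differentiableAt_inChart (J : ComplexStructure I M) (p : M) :
    DifferentiableAt ℝ (J.J.inChart I p) (extChartAt I p p) :=
  ((contMDiffAt_endField_iff J.J p).1 (J.smooth p)).differentiableAt (by simp)

theorem ComplexStructure.nijenhuisTensor_eq_zero [CompleteSpace E] (J : ComplexStructure I M)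
    (p : M) (v w : E) : nijenhuisTensor (J.J.inChart I p) (extChartAt I p p) v w = 0 := by
  obtain ⟨X, hX, rfl⟩ := exists_contMDiffAt_field (I := I) p v
  obtain ⟨Y, hY, rfl⟩ := exists_contMDiffAt_field (I := I) p w
  rw [← nijenhuis_eq_nijenhuisTensor (J.differentiableAt_inChart p) (J.sq p) hX hY]
  exact J.integrable p X Y hX hY

theorem DiffForm.d_eq_extDeriv {n : ℕ} (α : DiffForm I M n) (p : M) :
    DiffForm.d I α p = extDeriv (α.inChart I p) (extChartAt I p p) := by
  have h : mvfderiv I (extChartAt I p) p = ContinuousLinearMap.id ℝ E := chartDeriv_self (I := I) p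
  rw [DiffForm.d, I.range_eq_univ, extDerivWithin_univ, h]
  rfl

omit [IsManifold I ∞ M] [I.Boundaryless] in
theorem DiffForm.inChart_apply {n : ℕ} (α : DiffForm I M n) (p : M) (u : E) (v : Fin n → E) :
    α.inChart I p u v = (show E [⋀^Fin n]→L[ℝ] ℝ from α ((extChartAt I p).symm u))
      (fun i => symmDeriv I p u (v i)) := rfl

theorem DiffForm.d_eq_zero_of_eventually_const {n : ℕ} (α : DiffForm I M n) (p : M)
    (β : E [⋀^Fin n]→L[ℝ] ℝ) (h : ∀ᶠ u in 𝓝 (extChartAt I p p), α.inChart I p u = β) :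
    DiffForm.d I α p = 0 := by
  rw [DiffForm.d_eq_extDeriv, Filter.EventuallyEq.extDeriv_eq (ω₂ := fun _ => β) h, extDeriv,
    fderiv_fun_const]
  exact map_zero (ContinuousAlternatingMap.alternatizeUncurryFinCLM ℝ E ℝ)

/-- Differential forms in charts take values in alternating maps, whereas the computations below use
curried bilinear maps; this is the bridge between the two. -/
theorem DiffForm.d_apply_of_bilin (α : DiffForm I M 2) (p : M) (B : E → E →L[ℝ] E →L[ℝ] ℝ)
    (hB : DifferentiableAt ℝ B (extChartAt I p p))
    (h : ∀ᶠ u in 𝓝 (extChartAt I p p), ∀ v, α.inChart I p u v = B u (v 0) (v 1))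
    (v : Fin 3 → E) :
    (show E [⋀^Fin 3]→L[ℝ] ℝ from DiffForm.d I α p) v =
      fderiv ℝ B (extChartAt I p p) (v 0) (v 1) (v 2)
      - fderiv ℝ B (extChartAt I p p) (v 1) (v 0) (v 2)
      + fderiv ℝ B (extChartAt I p p) (v 2) (v 0) (v 1) := by
  set u₀ := extChartAt I p p with hu₀
  -- Half the antisymmetrization is a continuous linear projection that fixes alternating bilinear
  -- maps. As `B u` is alternating near the base point, the form equals `alt (B u)` and inherits
  -- differentiability from `B`.
  obtain ⟨alt, halt⟩ : ∃ alt : (E →L[ℝ] E →L[ℝ] ℝ) →L[ℝ] E [⋀^Fin 2]→L[ℝ] ℝ,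
      ∀ b w, alt b w = (1 / 2 : ℝ) * (b (w 0) (w 1) - b (w 1) (w 0)) := by
    refine ⟨((1 / 2 : ℝ) • ContinuousAlternatingMap.alternatizeUncurryFinCLM ℝ E ℝ).comp
      (ContinuousLinearMap.compL ℝ E (E →L[ℝ] ℝ) (E [⋀^Fin 1]→L[ℝ] ℝ)
        ((ContinuousAlternatingMap.ofSubsingletonLIE (𝕜 := ℝ) (E := E) (F := ℝ)
          (0 : Fin 1)).toContinuousLinearEquiv : (E →L[ℝ] ℝ) →L[ℝ] E [⋀^Fin 1]→L[ℝ] ℝ)), ?_⟩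
    intro b w
    change (1 / 2 : ℝ) * (ContinuousAlternatingMap.alternatizeUncurryFin _ w) = _
    rw [ContinuousAlternatingMap.alternatizeUncurryFin_apply, Fin.sum_univ_two]
    simp [ContinuousAlternatingMap.ofSubsingletonLIE, Fin.removeNth, sub_eq_add_neg]
    rfl
  have h1 : α.inChart I p =ᶠ[𝓝 u₀] fun u => alt (B u) := by
    filter_upwards [h] with u hu
    ext w
    rw [halt, ← hu w]
    have h1 := hu ![w 1, w 0]
    have h2 : α.inChart I p u ![w 1, w 0] = - α.inChart I p u w := by
      have := (α.inChart I p u).map_swap w (i := 0) (j := 1) (by decide)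
      refine Eq.trans ?_ this
      change _ = α.inChart I p u _
      congr 1
      ext i
      fin_cases i <;> simp
    rw [h2] at h1
    simp only [Matrix.cons_val_zero, Matrix.cons_val_one] at h1
    rw [← h1]
    ring
  have h2 : DifferentiableAt ℝ (fun u => alt (B u)) u₀ := DifferentiableAt.comp u₀ (g := alt) (ContinuousLinearMap.differentiableAt alt (x := B u₀)) hB
  have h3 : ∀ x y z : E, fderiv ℝ (fun u => α.inChart I p u ![y, z]) u₀ x = fderiv ℝ B u₀ x y z := by
    intro x y z
    have : (fun u => α.inChart I p u ![y, z]) =ᶠ[𝓝 u₀] fun u => B u y z := by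
      filter_upwards [h] with u hu using hu _
    rw [this.fderiv_eq, fderiv_clm_apply (hB.clm_apply (differentiableAt_const y)) (differentiableAt_const z),
      fderiv_clm_apply hB (differentiableAt_const y)]
    simp
  rw [DiffForm.d_eq_extDeriv]
  refine (extDeriv_apply (h1.differentiableAt_iff.2 h2) v).trans ?_
  have r0 : (0 : Fin 3).removeNth v = ![v 1, v 2] := by ext i; fin_cases i <;> rfl
  have r1 : (1 : Fin 3).removeNth v = ![v 0, v 2] := by ext i; fin_cases i <;> rfl
  have r2 : (2 : Fin 3).removeNth v = ![v 0, v 1] := by ext i; fin_cases i <;> rfl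
  rw [Fin.sum_univ_three, r0, r1, r2, h3, h3, h3]
  simp
  ring

end ChartTensors

/-! ### Charts of a quotient whose projection is a local homeomorphism -/

section QuotientChart

variable {E H M M' : Type*} [NormedAddCommGroup E] [NormedSpace ℝ E] [TopologicalSpace H]
  {I : ModelWithCorners ℝ E H} [TopologicalSpace M] [TopologicalSpace M'] [ChartedSpace H M]
  [inst : ChartedSpace H M'] {q : M → M'} {hq : IsLocalHomeomorph q}
  {hs : Function.Surjective q}

/-- The charted space on the quotient enters as an instance together with the equation `h`, which is
`rfl` both for the torus and for the mapping torus. -/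
theorem extChartAt_symm_quotient (h : inst = hq.chartedSpace hs) (p : M') :
    ⇑(extChartAt I p).symm = q ∘ (extChartAt I (hs.hasRightInverse.choose p)).symm := by
  subst h
  ext u
  simp only [mfld_simps]
  exact congrFun (hq.localInverseAt_symm _) _

theorem mem_target_of_quotient (h : inst = hq.chartedSpace hs) {p : M'} {u : E}
    (hu : u ∈ (extChartAt I p).target) :
    u ∈ (extChartAt I (hs.hasRightInverse.choose p)).target := by
  subst h
  simp only [mfld_simps, mem_preimage] at hu ⊢
  exact ⟨hu.1, hu.2.1⟩

theorem extChartAt_self_quotient (h : inst = hq.chartedSpace hs) (p : M') :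
    extChartAt I p p =
      extChartAt I (hs.hasRightInverse.choose p) (hs.hasRightInverse.choose p) := by
  subst h
  have h1 := hs.hasRightInverse.choose_spec p
  set x := hs.hasRightInverse.choose p
  change I (chartAt H x (hq.localInverseAt x p)) = I (chartAt H x x)
  congr 2
  conv_lhs => rw [← h1]
  exact hq.localInverseAt_apply_self

theorem quotient_eventuallyEq (h : inst = hq.chartedSpace hs) (p : M') :
    q =ᶠ[𝓝 (hs.hasRightInverse.choose p)]
      (extChartAt I p).symm ∘ extChartAt I (hs.hasRightInverse.choose p) := by
  filter_upwards [extChartAt_source_mem_nhds (I := I) (hs.hasRightInverse.choose p)] with x hx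
  rw [extChartAt_symm_quotient h, Function.comp_apply, Function.comp_apply,
    (extChartAt I (hs.hasRightInverse.choose p)).left_inv hx]

variable [IsManifold I ∞ M] [IsManifold I ∞ M'] [I.Boundaryless]

omit [IsManifold I ∞ M] in
theorem contMDiffAt_quotient_lift (h : inst = hq.chartedSpace hs) (p : M') :
    ContMDiffAt I I ∞ q (hs.hasRightInverse.choose p) := by
  refine ContMDiffAt.congr_of_eventuallyEq ?_ (quotient_eventuallyEq (I := I) h p)
  refine ContMDiffAt.comp (I' := 𝓘(ℝ, E)) _ ?_ contMDiffAt_extChartAt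
  rw [← extChartAt_self_quotient h]
  exact (contMDiffOn_extChartAt_symm (I := I) p).contMDiffAt (extChartAt_target_mem_nhds p)

/-- The preferred chart at `p` is the local inverse of `q` followed by the chart at the chosen
preimage, so `q` reads as the identity in these two charts. -/
theorem mfderiv_quotient_lift (h : inst = hq.chartedSpace hs) (p : M') :
    (show E →L[ℝ] E from mfderiv I I q (hs.hasRightInverse.choose p)) = .id ℝ E := by
  have : IsManifold I 1 M := .of_le (n := ∞) (by simp)
  set x := hs.hasRightInverse.choose p with hx
  have h1 := (quotient_eventuallyEq (I := I) h p).mfderiv_eq (I := I) (I' := I)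
  have hm : MDifferentiableAt 𝓘(ℝ, E) I (extChartAt I p).symm (extChartAt I x x) := by
    rw [hx, ← extChartAt_self_quotient h]
    exact ((contMDiffOn_extChartAt_symm (n := ∞) p).contMDiffAt
      (extChartAt_target_mem_nhds p)).mdifferentiableAt (by simp)
  have h2 := mfderiv_comp x hm (mdifferentiableAt_extChartAt (mem_chart_source H x))
  have h3 : (show E →L[ℝ] E from mfderiv 𝓘(ℝ, E) I (extChartAt I p).symm (extChartAt I x x)) =
      .id ℝ E := by
    rw [hx, ← extChartAt_self_quotient h, ← mfderivWithin_univ, ← I.range_eq_univ]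
    exact symmDeriv_self p
  have h4 : (show E →L[ℝ] E from mfderiv I 𝓘(ℝ, E) (extChartAt I x) x) = .id ℝ E :=
    chartDeriv_self x
  refine (h1.trans h2).trans ?_
  exact (congrArg₂ (fun A B : E →L[ℝ] E => A.comp B) h3 h4).trans (ContinuousLinearMap.id_comp _)

-- Smoothness at the chosen preimages is immediate from the charts; a deck transformation carries it
-- to every other point of the fibre.
omit [IsManifold I ∞ M] in
theorem contMDiff_quotient (h : inst = hq.chartedSpace hs)
    (deck : ∀ a b : M, q a = q b →
      ∃ φ : M → M, ContMDiff I I ∞ φ ∧ (∀ z, q (φ z) = q z) ∧ φ a = b) :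
    ContMDiff I I ∞ q := by
  intro x
  obtain ⟨φ, hφ, hφq, hφx⟩ := deck x (hs.hasRightInverse.choose (q x))
    (hs.hasRightInverse.choose_spec (q x)).symm
  have h1 : q = q ∘ φ := funext fun z => (hφq z).symm
  rw [h1]
  refine ContMDiffAt.comp x ?_ (hφ x)
  rw [hφx]
  exact contMDiffAt_quotient_lift h (q x)

omit [IsManifold I ∞ M'] [I.Boundaryless] in
theorem symmDeriv_quotient (h : inst = hq.chartedSpace hs) (hsm : ContMDiff I I ∞ q)
    {p : M'} {u : E} (hu : u ∈ (extChartAt I p).target) :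
    symmDeriv I p u =
      (show E →L[ℝ] E from mfderiv I I q
        ((extChartAt I (hs.hasRightInverse.choose p)).symm u)).comp
        (symmDeriv I (hs.hasRightInverse.choose p) u) := by
  have : IsManifold I 1 M := .of_le (n := ∞) (by simp)
  have hu' := mem_target_of_quotient h hu
  rw [symmDeriv, extChartAt_symm_quotient h]
  exact mfderiv_comp_mfderivWithin (I' := I) u (hsm.mdifferentiableAt (by simp))
    (mdifferentiableWithinAt_extChartAt_symm hu')
    (I.uniqueMDiffOn _ (extChartAt_target_subset_range _ hu'))

end QuotientChart

/-! ### Charts of products and of the model space -/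

section ProdChart

variable {E₁ H₁ M₁ E₂ H₂ M₂ : Type*} [NormedAddCommGroup E₁] [NormedSpace ℝ E₁]
  [TopologicalSpace H₁] {I₁ : ModelWithCorners ℝ E₁ H₁} [TopologicalSpace M₁] [ChartedSpace H₁ M₁]
  [NormedAddCommGroup E₂] [NormedSpace ℝ E₂]
  [TopologicalSpace H₂] {I₂ : ModelWithCorners ℝ E₂ H₂} [TopologicalSpace M₂] [ChartedSpace H₂ M₂]
  [IsManifold I₁ ∞ M₁] [IsManifold I₂ ∞ M₂]

theorem symmDeriv_prod {p : M₁ × M₂} {u : E₁ × E₂}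
    (h₁ : u.1 ∈ (extChartAt I₁ p.1).target) (h₂ : u.2 ∈ (extChartAt I₂ p.2).target) :
    symmDeriv (I₁.prod I₂) p u = (symmDeriv I₁ p.1 u.1).prodMap (symmDeriv I₂ p.2 u.2) := by
  have : IsManifold I₁ 1 M₁ := .of_le (n := ∞) (by simp)
  have : IsManifold I₂ 1 M₂ := .of_le (n := ∞) (by simp)
  have hr : range (I₁.prod I₂) = range I₁ ×ˢ range I₂ := modelWithCorners_prod_coe I₁ I₂ ▸ range_prodMap
  rw [symmDeriv, extChartAt_prod, hr, modelWithCornersSelf_prod, ← chartedSpaceSelf_prod]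
  have hd₁ := mdifferentiableWithinAt_extChartAt_symm (I := I₁) h₁
  have hd₂ := mdifferentiableWithinAt_extChartAt_symm (I := I₂) h₂
  exact mfderivWithin_prodMap (p := u) hd₁ hd₂
    (I₁.uniqueMDiffOn _ (extChartAt_target_subset_range _ h₁))
    (I₂.uniqueMDiffOn _ (extChartAt_target_subset_range _ h₂))

end ProdChart

theorem symmDeriv_model {F : Type*} [NormedAddCommGroup F] [NormedSpace ℝ F] (p u : F) :
    symmDeriv 𝓘(ℝ, F) p u = .id ℝ F := by
  rw [symmDeriv, extChartAt_model_space_eq_id, modelWithCornersSelf_coe, range_id,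
    mfderivWithin_univ]
  exact mfderiv_id

/-! ### Flat coordinates of the torus -/

namespace Torus
variable (Γ : Submodule ℤ R3)

theorem exists_translation (a b : R3) (hab : proj Γ a = proj Γ b) :
    ∃ w : R3, (∀ z, proj Γ (w + z) = proj Γ z) ∧ w + a = b := by
  obtain ⟨g, hg⟩ : ∃ g : Γ.toAddSubgroup, g +ᵥ b = a := Quotient.exact hab
  refine ⟨((-g : Γ.toAddSubgroup) : R3), fun z => Quotient.sound ⟨-g, rfl⟩, ?_⟩
  rw [← hg]
  simp [AddSubgroup.vadd_def]

variable [DiscreteTopology Γ]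

theorem contMDiff_proj : ContMDiff 𝓘(ℝ, R3) 𝓘(ℝ, R3) ∞ (proj Γ) := by
  refine contMDiff_quotient (hq := isLocalHomeomorph_proj Γ) (hs := proj_surjective Γ) rfl
    fun a b hab => ?_
  obtain ⟨w, hw, h⟩ := exists_translation Γ a b hab
  exact ⟨fun z => w + z, (contDiff_const.add contDiff_id).contMDiff, hw, h⟩

/-- At chosen preimages this is a fact about quotient charts; elsewhere a lattice translation, whose
derivative is the identity, moves `v` to such a preimage. Consequently all tangent spaces of the
torus are identified with `ℝ³` by the global frame `∂₁, ∂₂, ∂₃`. -/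
theorem mfderiv_proj (v : R3) :
    (show R3 →L[ℝ] R3 from mfderiv 𝓘(ℝ, R3) 𝓘(ℝ, R3) (proj Γ) v) = .id ℝ R3 := by
  obtain ⟨w, hw, h⟩ := exists_translation Γ v
    ((proj_surjective Γ).hasRightInverse.choose (proj Γ v))
    ((proj_surjective Γ).hasRightInverse.choose_spec (proj Γ v)).symm
  have h1 : proj Γ = proj Γ ∘ fun z => w + z := funext fun z => (hw z).symm
  have h2 : (show R3 →L[ℝ] R3 from mfderiv 𝓘(ℝ, R3) 𝓘(ℝ, R3) (proj Γ) (w + v)) = .id ℝ R3 := by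
    rw [h]
    exact mfderiv_quotient_lift (hq := isLocalHomeomorph_proj Γ) (hs := proj_surjective Γ) rfl _
  have h3 : (show R3 →L[ℝ] R3 from mfderiv 𝓘(ℝ, R3) 𝓘(ℝ, R3) (fun z : R3 => w + z) v) =
      .id ℝ R3 := by
    rw [mfderiv_eq_fderiv]
    exact (fderiv_const_add w).trans fderiv_id
  have h4 := mfderiv_comp (I := 𝓘(ℝ, R3)) (I' := 𝓘(ℝ, R3)) (I'' := 𝓘(ℝ, R3)) (g := proj Γ)
    (f := fun z : R3 => w + z) v ((contMDiff_proj Γ).mdifferentiableAt (by simp))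
    ((contDiff_const.add contDiff_id : ContDiff ℝ ∞ fun z : R3 => w + z).contMDiff.mdifferentiableAt
      (by simp))
  rw [← h1] at h4
  refine h4.trans ?_
  exact (congrArg₂ (fun A B : R3 →L[ℝ] R3 => A.comp B) h2 h3).trans (ContinuousLinearMap.id_comp _)

theorem symmDeriv_eq_id {x : Torus Γ} {u : R3} (hu : u ∈ (extChartAt 𝓘(ℝ, R3) x).target) :
    symmDeriv 𝓘(ℝ, R3) x u = .id ℝ R3 := by
  rw [symmDeriv_quotient (hq := isLocalHomeomorph_proj Γ) (hs := proj_surjective Γ) rfl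
    (contMDiff_proj Γ) hu, symmDeriv_model, mfderiv_proj]
  rfl

theorem dx_eq (i : Fin 3) (x : Torus Γ) :
    (show R3 →L[ℝ] ℝ from dx Γ i x) = EuclideanSpace.proj i := by
  have h1 := mvfderiv_comp (I := 𝓘(ℝ, R3)) (I' := 𝓘(ℝ, R3)) (f := extChartAt 𝓘(ℝ, R3) x)
    (g := (EuclideanSpace.proj i : R3 →L[ℝ] ℝ)) x
    (EuclideanSpace.proj i : R3 →L[ℝ] ℝ).mdifferentiableAt
    (mdifferentiableAt_extChartAt (mem_chart_source R3 x))
  have h2 : (show R3 →L[ℝ] ℝ from mvfderiv 𝓘(ℝ, R3) (EuclideanSpace.proj i : R3 →L[ℝ] ℝ)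
      (extChartAt 𝓘(ℝ, R3) x x)) = EuclideanSpace.proj i := by
    have := (EuclideanSpace.proj i : R3 →L[ℝ] ℝ).fderiv (x := extChartAt 𝓘(ℝ, R3) x x)
    rw [← mfderiv_eq_fderiv] at this
    exact this
  refine h1.trans ?_
  exact (congrArg₂ (fun (A : R3 →L[ℝ] ℝ) (B : R3 →L[ℝ] R3) => A.comp B) h2
    (chartDeriv_self (I := 𝓘(ℝ, R3)) x)).trans (ContinuousLinearMap.comp_id _)

theorem dd_eq (i : Fin 3) (x : Torus Γ) :
    (show R3 from dd Γ i x) = EuclideanSpace.single i (1 : ℝ) := by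
  have h : (chartDeriv 𝓘(ℝ, R3) x x).inverse = .id ℝ R3 := by
    rw [chartDeriv_self, ContinuousLinearMap.inverse_id]
  exact congrArg (fun L : R3 →L[ℝ] R3 => L (EuclideanSpace.single i (1 : ℝ))) h

end Torus

/-! ### Families of metrics and two-forms depending on one covector -/

section BilinearForms

variable {V F : Type*} [NormedAddCommGroup V] [NormedSpace ℝ V] [NormedAddCommGroup F]
  [NormedSpace ℝ F]

/-- The pullback of bilinear forms under a continuous linear map. -/
noncomputable def bilPull (n : V →L[ℝ] F) : (F →L[ℝ] F →L[ℝ] ℝ) →L[ℝ] V →L[ℝ] V →L[ℝ] ℝ :=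
  (ContinuousLinearMap.compL ℝ V (F →L[ℝ] ℝ) (V →L[ℝ] ℝ)
    ((ContinuousLinearMap.compL ℝ V F ℝ).flip n)).comp
    ((ContinuousLinearMap.compL ℝ V F (F →L[ℝ] ℝ)).flip n)

theorem bilPull_apply (n : V →L[ℝ] F) (B : F →L[ℝ] F →L[ℝ] ℝ) (v w : V) :
    bilPull n B v w = B (n v) (n w) := rfl

/-- The bilinear form `x ∧ y` for two covectors `x`, `y`. -/
noncomputable def wedge (x y : V →L[ℝ] ℝ) : V →L[ℝ] V →L[ℝ] ℝ := x.smulRight y - y.smulRight x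

variable (c : Fin 3 → V →L[ℝ] ℝ) (t : V →L[ℝ] ℝ) (n : V →L[ℝ] F)

/-- The symmetric bilinear form `a⁻² (c¹)² + l⁻¹ ((c²)² + (c³)²) + n^*B + t²`. -/
noncomputable def splitMet (a l : ℝ) (B : F →L[ℝ] F →L[ℝ] ℝ) : V →L[ℝ] V →L[ℝ] ℝ :=
  (a⁻¹ * a⁻¹) • (c 0).smulRight (c 0) + l⁻¹ • ((c 1).smulRight (c 1) + (c 2).smulRight (c 2))
    + bilPull n B + t.smulRight t

theorem splitMet_apply (a l : ℝ) (B : F →L[ℝ] F →L[ℝ] ℝ) (v w : V) :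
    splitMet c t n a l B v w = a⁻¹ * c 0 v * (a⁻¹ * c 0 w)
      + l⁻¹ * (c 1 v * c 1 w + c 2 v * c 2 w) + B (n v) (n w) + t v * t w := by
  simp only [splitMet, add_apply, smul_apply, ContinuousLinearMap.smulRight_apply, bilPull_apply,
    smul_eq_mul]
  ring

/-- The bilinear form `a⁻¹ c¹ ∧ t + s c² ∧ c³ + n^*B`. -/
noncomputable def splitForm (a s : ℝ) (B : F →L[ℝ] F →L[ℝ] ℝ) : V →L[ℝ] V →L[ℝ] ℝ :=
  a⁻¹ • wedge (c 0) t + s • wedge (c 1) (c 2) + bilPull n B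

theorem splitForm_apply (a s : ℝ) (B : F →L[ℝ] F →L[ℝ] ℝ) (v w : V) :
    splitForm c t n a s B v w = a⁻¹ * (c 0 v * t w - t v * c 0 w)
      + s * (c 1 v * c 2 w - c 2 v * c 1 w) + B (n v) (n w) := by
  simp only [splitForm, wedge, add_apply, sub_apply, smul_apply,
    ContinuousLinearMap.smulRight_apply, bilPull_apply, smul_eq_mul]

theorem hasFDerivAt_smul_of_hasDerivAt {G : Type*} [NormedAddCommGroup G] [NormedSpace ℝ G]
    {f : ℝ → ℝ} {f' : ℝ} {u : V} (hf : HasDerivAt f f' (t u)) (T : G) :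
    HasFDerivAt (fun z => f (t z) • T) ((f' • t).smulRight T) u :=
  (HasDerivAt.comp_hasFDerivAt (h₂ := f) (f := t) u hf t.hasFDerivAt).smul_const T

/-- The alternation of the derivative of a smooth family `a⁻¹ c¹ ∧ t + s c² ∧ c³ + n^*B`. -/
theorem alternation_fderiv_splitForm {a' s' : ℝ} {a s : ℝ → ℝ} {B : F → F →L[ℝ] F →L[ℝ] ℝ} {u : V}
    (ha : HasDerivAt (fun r => (a r)⁻¹) a' (t u)) (hs : HasDerivAt s s' (t u))
    (hB : DifferentiableAt ℝ B (n u)) :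
    DifferentiableAt ℝ (fun z => splitForm c t n (a (t z)) (s (t z)) (B (n z))) u ∧
    ∀ v₀ v₁ v₂ : V, fderiv ℝ B (n u) (n v₀) (n v₁) (n v₂) - fderiv ℝ B (n u) (n v₁) (n v₀) (n v₂)
        + fderiv ℝ B (n u) (n v₂) (n v₀) (n v₁) = 0 →
      fderiv ℝ (fun z => splitForm c t n (a (t z)) (s (t z)) (B (n z))) u v₀ v₁ v₂
        - fderiv ℝ (fun z => splitForm c t n (a (t z)) (s (t z)) (B (n z))) u v₁ v₀ v₂
        + fderiv ℝ (fun z => splitForm c t n (a (t z)) (s (t z)) (B (n z))) u v₂ v₀ v₁ =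
      s' * (t v₀ * (c 1 v₁ * c 2 v₂ - c 2 v₁ * c 1 v₂) - t v₁ * (c 1 v₀ * c 2 v₂ - c 2 v₀ * c 1 v₂)
        + t v₂ * (c 1 v₀ * c 2 v₁ - c 2 v₀ * c 1 v₁)) := by
  have hN : HasFDerivAt (fun z => bilPull n (B (n z)))
      ((bilPull n).comp ((fderiv ℝ B (n u)).comp n)) u :=
    HasFDerivAt.comp (g := bilPull n) u (ContinuousLinearMap.hasFDerivAt (bilPull n))
      (HasFDerivAt.comp (g := B) (f := n) u hB.hasFDerivAt n.hasFDerivAt)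
  have h : HasFDerivAt (fun z => splitForm c t n (a (t z)) (s (t z)) (B (n z))) _ u :=
    ((hasFDerivAt_smul_of_hasDerivAt t ha (wedge (c 0) t)).add
      (hasFDerivAt_smul_of_hasDerivAt t hs (wedge (c 1) (c 2)))).add hN
  refine ⟨h.differentiableAt, fun v₀ v₁ v₂ h0 => ?_⟩
  rw [h.fderiv]
  simp only [add_apply, sub_apply, smul_apply, ContinuousLinearMap.smulRight_apply, wedge,
    ContinuousLinearMap.comp_apply, bilPull_apply, smul_eq_mul]
  -- The coefficient `a'` multiplies `t ∧ c¹ ∧ t = 0`, and `h0` removes the contribution of `B`;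
  -- only `s' t ∧ c² ∧ c³` is left.
  linear_combination h0

theorem contDiffAt_splitMet {a l : ℝ → ℝ} {B : F → F →L[ℝ] F →L[ℝ] ℝ} {u : V}
    (ha : ContDiffAt ℝ ∞ a (t u)) (ha0 : a (t u) ≠ 0) (hl : ContDiffAt ℝ ∞ l (t u))
    (hl0 : l (t u) ≠ 0) (hB : ContDiffAt ℝ ∞ B (n u)) :
    ContDiffAt ℝ ∞ (fun z => splitMet c t n (a (t z)) (l (t z)) (B (n z))) u := by
  have h1 : ContDiffAt ℝ ∞ (fun z => a (t z)) u := ha.comp u t.contDiff.contDiffAt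
  have h2 : ContDiffAt ℝ ∞ (fun z => l (t z)) u := hl.comp u t.contDiff.contDiffAt
  have h3 : ContDiffAt ℝ ∞ (fun z => B (n z)) u := hB.comp u n.contDiff.contDiffAt
  exact (((((h1.inv ha0).mul (h1.inv ha0)).smul contDiffAt_const).add
    ((h2.inv hl0).smul contDiffAt_const)).add
    (ContDiffAt.comp (g := bilPull n) u (ContinuousLinearMap.contDiff (bilPull n)).contDiffAt h3)).add
    contDiffAt_const

end BilinearForms

/-! ### The split structures on the model space `(ℝ³ × F) × ℝ` -/

namespace SplitModel

variable {F : Type*} [NormedAddCommGroup F] [NormedSpace ℝ F]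

/-- The coordinate `x^(i+1)` on `(ℝ³ × F) × ℝ`. -/
noncomputable def crd (i : Fin 3) : (R3 × F) × ℝ →L[ℝ] ℝ :=
  (EuclideanSpace.proj i : R3 →L[ℝ] ℝ).comp
    ((ContinuousLinearMap.fst ℝ R3 F).comp (ContinuousLinearMap.fst ℝ (R3 × F) ℝ))

/-- The coordinate `t` on `(ℝ³ × F) × ℝ`. -/
noncomputable def tim : (R3 × F) × ℝ →L[ℝ] ℝ := ContinuousLinearMap.snd ℝ (R3 × F) ℝ

/-- The projection of `(ℝ³ × F) × ℝ` onto `F`. -/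
noncomputable def toN : (R3 × F) × ℝ →L[ℝ] F :=
  (ContinuousLinearMap.snd ℝ R3 F).comp (ContinuousLinearMap.fst ℝ (R3 × F) ℝ)

/-- The inclusion of `F` into `(ℝ³ × F) × ℝ`. -/
noncomputable def ofN : F →L[ℝ] (R3 × F) × ℝ :=
  (ContinuousLinearMap.inl ℝ (R3 × F) ℝ).comp (ContinuousLinearMap.inr ℝ R3 F)

/-- The basis vector dual to `crd i`. -/
noncomputable def bas (i : Fin 3) : (R3 × F) × ℝ := ((EuclideanSpace.single i 1, 0), 0)

@[simp] theorem crd_apply (i : Fin 3) (v : (R3 × F) × ℝ) : crd i v = v.1.1 i := rfl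
@[simp] theorem tim_apply (v : (R3 × F) × ℝ) : tim v = v.2 := rfl
@[simp] theorem toN_apply (v : (R3 × F) × ℝ) : toN v = v.1.2 := rfl
@[simp] theorem ofN_apply (ξ : F) : ofN ξ = (((0, ξ), 0) : (R3 × F) × ℝ) := rfl

omit [NormedAddCommGroup F] [NormedSpace ℝ F] in
theorem ext_coords {v w : (R3 × F) × ℝ} (h0 : v.1.1 0 = w.1.1 0) (h1 : v.1.1 1 = w.1.1 1)
    (h2 : v.1.1 2 = w.1.1 2) (hN : v.1.2 = w.1.2) (ht : v.2 = w.2) : v = w := by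
  refine Prod.ext (Prod.ext ?_ hN) ht
  ext i
  fin_cases i
  exacts [h0, h1, h2]

variable (F) in
/-- The `t`-dependence of the complex structures through `a`. -/
noncomputable def cplxA : (R3 × F) × ℝ →L[ℝ] (R3 × F) × ℝ := tim.smulRight (bas 0)

variable (F) in
/-- The `t`-dependence of the complex structures through `a⁻¹`. -/
noncomputable def cplxB : (R3 × F) × ℝ →L[ℝ] (R3 × F) × ℝ := (crd 0).smulRight (0, 1)

variable (F) in
/-- The rotation of the plane spanned by the second and the third coordinate vectors. -/
noncomputable def cplxR : (R3 × F) × ℝ →L[ℝ] (R3 × F) × ℝ :=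
  (crd 1).smulRight (bas 2) - (crd 2).smulRight (bas 1)

/-- An endomorphism of `F` acting on the summand `F` of `(ℝ³ × F) × ℝ`. -/
noncomputable def cplxN : (F →L[ℝ] F) →L[ℝ] (R3 × F) × ℝ →L[ℝ] (R3 × F) × ℝ :=
  (ContinuousLinearMap.compL ℝ ((R3 × F) × ℝ) F ((R3 × F) × ℝ) ofN).comp
    ((ContinuousLinearMap.compL ℝ ((R3 × F) × ℝ) F F).flip toN)

/-- The complex structure `∂₁ ↦ a⁻¹ ∂ₜ`, `∂₂ ↦ σ ∂₃`, `∂₃ ↦ -σ ∂₂`, `ξ ↦ A ξ`. -/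
noncomputable def cplx (σ a : ℝ) (A : F →L[ℝ] F) : (R3 × F) × ℝ →L[ℝ] (R3 × F) × ℝ :=
  a⁻¹ • cplxB F - a • cplxA F + σ • cplxR F + cplxN A

theorem cplx_apply (σ a : ℝ) (A : F →L[ℝ] F) (v : (R3 × F) × ℝ) :
    (cplx σ a A v).1.1 0 = -(a * v.2) ∧ (cplx σ a A v).1.1 1 = -(σ * v.1.1 2) ∧
      (cplx σ a A v).1.1 2 = σ * v.1.1 1 ∧ (cplx σ a A v).1.2 = A v.1.2 ∧
      (cplx σ a A v).2 = a⁻¹ * v.1.1 0 := by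
  refine ⟨?_, ?_, ?_, ?_, ?_⟩ <;> simp [cplx, cplxA, cplxB, cplxR, cplxN, bas]

theorem cplx_sq {σ a : ℝ} (hσ : σ * σ = 1) (ha : a ≠ 0) {A : F →L[ℝ] F} {v : (R3 × F) × ℝ}
    (hA : A (A v.1.2) = -v.1.2) : cplx σ a A (cplx σ a A v) = -v := by
  obtain ⟨h0, h1, h2, h3, h4⟩ := cplx_apply σ a A v
  obtain ⟨k0, k1, k2, k3, k4⟩ := cplx_apply σ a A (cplx σ a A v)
  refine ext_coords ?_ ?_ ?_ ?_ ?_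
  · rw [k0, h4]; simp [ha]
  · rw [k1, h2]; simp [← mul_assoc, hσ]
  · rw [k2, h1]; simp [← mul_assoc, hσ]
  · rw [k3, h3, hA]; simp
  · rw [k4, h0]; simp [ha]

/-- The operators for `σ` and `τ` agree off the `(x², x³)` plane and are multiples of one rotation
on it. -/
theorem cplx_comm (σ τ a : ℝ) (A : F →L[ℝ] F) (v : (R3 × F) × ℝ) :
    cplx σ a A (cplx τ a A v) = cplx τ a A (cplx σ a A v) := by
  obtain ⟨h0, h1, h2, h3, h4⟩ := cplx_apply σ a A v
  obtain ⟨l0, l1, l2, l3, l4⟩ := cplx_apply τ a A v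
  obtain ⟨k0, k1, k2, k3, k4⟩ := cplx_apply τ a A (cplx σ a A v)
  obtain ⟨m0, m1, m2, m3, m4⟩ := cplx_apply σ a A (cplx τ a A v)
  refine ext_coords ?_ ?_ ?_ ?_ ?_
  · rw [m0, k0, h4, l4]
  · rw [m1, k1, h2, l2]; ring
  · rw [m2, k2, h1, l1]; ring
  · rw [m3, k3, h3, l3]
  · rw [m4, k4, h0, l0]

/-- The metric `a⁻² (dx¹)² + l⁻¹ ((dx²)² + (dx³)²) + B + dt²`. -/
noncomputable def met (a l : ℝ) (B : F →L[ℝ] F →L[ℝ] ℝ) :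
    (R3 × F) × ℝ →L[ℝ] (R3 × F) × ℝ →L[ℝ] ℝ := splitMet crd tim toN a l B

theorem met_apply (a l : ℝ) (B : F →L[ℝ] F →L[ℝ] ℝ) (v w : (R3 × F) × ℝ) :
    met a l B v w = a⁻¹ * v.1.1 0 * (a⁻¹ * w.1.1 0)
      + l⁻¹ * (v.1.1 1 * w.1.1 1 + v.1.1 2 * w.1.1 2) + B v.1.2 w.1.2 + v.2 * w.2 := by
  rw [met, splitMet_apply]
  simp only [crd_apply, tim_apply, toN_apply]

/-- The bilinear form `a⁻¹ dx¹ ∧ dt + s dx² ∧ dx³ + B`. -/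
noncomputable def form (a s : ℝ) (B : F →L[ℝ] F →L[ℝ] ℝ) :
    (R3 × F) × ℝ →L[ℝ] (R3 × F) × ℝ →L[ℝ] ℝ := splitForm crd tim toN a s B

theorem form_apply (a s : ℝ) (B : F →L[ℝ] F →L[ℝ] ℝ) (v w : (R3 × F) × ℝ) :
    form a s B v w = a⁻¹ * (v.1.1 0 * w.2 - v.2 * w.1.1 0)
      + s * (v.1.1 1 * w.1.1 2 - v.1.1 2 * w.1.1 1) + B v.1.2 w.1.2 := by
  rw [form, splitForm_apply]
  simp only [crd_apply, tim_apply, toN_apply]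

/-- This identifies the fundamental form. The sign `σ` and the function `l` enter only through the
coefficient of `dx² ∧ dx³`, so the exterior derivative sees only `σ (l⁻¹)'`. -/
theorem met_cplx_left {a : ℝ} (ha : a ≠ 0) (σ l : ℝ) (A : F →L[ℝ] F) (B : F →L[ℝ] F →L[ℝ] ℝ)
    (v w : (R3 × F) × ℝ) : met a l B (cplx σ a A v) w = form a (σ * l⁻¹) (B.comp A) v w := by
  obtain ⟨h0, h1, h2, h3, h4⟩ := cplx_apply σ a A v
  rw [met_apply, form_apply, h0, h1, h2, h3, h4, ContinuousLinearMap.comp_apply]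
  field_simp
  ring

theorem met_cplx_cplx {σ a : ℝ} (hσ : σ * σ = 1) (ha : a ≠ 0) (l : ℝ) {A : F →L[ℝ] F}
    {B : F →L[ℝ] F →L[ℝ] ℝ} {v w : (R3 × F) × ℝ}
    (h : B (A v.1.2) (A w.1.2) = B v.1.2 w.1.2) :
    met a l B (cplx σ a A v) (cplx σ a A w) = met a l B v w := by
  obtain ⟨h0, h1, h2, h3, h4⟩ := cplx_apply σ a A v
  obtain ⟨k0, k1, k2, k3, k4⟩ := cplx_apply σ a A w
  rw [met_apply, met_apply, h0, h1, h2, h3, h4, k0, k1, k2, k3, k4, h]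
  linear_combination (l⁻¹ * (v.1.1 1 * w.1.1 1 + v.1.1 2 * w.1.1 2)) * hσ
    + (a⁻¹ * a + 1) * v.2 * w.2 * inv_mul_cancel₀ ha

/-- The determinant `dx¹ ∧ dx² ∧ dx³`. -/
def vol (v₀ v₁ v₂ : (R3 × F) × ℝ) : ℝ :=
  v₀.1.1 0 * (v₁.1.1 1 * v₂.1.1 2 - v₁.1.1 2 * v₂.1.1 1)
    - v₁.1.1 0 * (v₀.1.1 1 * v₂.1.1 2 - v₀.1.1 2 * v₂.1.1 1)
    + v₂.1.1 0 * (v₀.1.1 1 * v₁.1.1 2 - v₀.1.1 2 * v₁.1.1 1)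

/-- The determinant `dt ∧ dx² ∧ dx³`. -/
def volT (v₀ v₁ v₂ : (R3 × F) × ℝ) : ℝ :=
  v₀.2 * (v₁.1.1 1 * v₂.1.1 2 - v₁.1.1 2 * v₂.1.1 1)
    - v₁.2 * (v₀.1.1 1 * v₂.1.1 2 - v₀.1.1 2 * v₂.1.1 1)
    + v₂.2 * (v₀.1.1 1 * v₁.1.1 2 - v₀.1.1 2 * v₁.1.1 1)

/-- The operator turns the covector `dt` into `-a⁻¹ dx¹` and acts on the `(x², x³)` plane with
determinant `σ * σ = 1`. The factor `a⁻¹` is what will cancel the `a` in `(l⁻¹)' = C a`. -/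
theorem volT_neg_cplx {σ : ℝ} (hσ : σ * σ = 1) (a : ℝ) (A : F →L[ℝ] F)
    (v₀ v₁ v₂ : (R3 × F) × ℝ) :
    volT (-cplx σ a A v₀) (-cplx σ a A v₁) (-cplx σ a A v₂) = -(a⁻¹ * vol v₀ v₁ v₂) := by
  obtain ⟨h0, h1, h2, h3, h4⟩ := cplx_apply σ a A v₀
  obtain ⟨k0, k1, k2, k3, k4⟩ := cplx_apply σ a A v₁
  obtain ⟨m0, m1, m2, m3, m4⟩ := cplx_apply σ a A v₂
  simp only [volT, vol, Prod.fst_neg, Prod.snd_neg, PiLp.neg_apply, h1, h2, h4, k1, k2, k4, m1, m2, m4]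
  linear_combination (-a⁻¹ * (v₀.1.1 0 * (v₁.1.1 1 * v₂.1.1 2 - v₁.1.1 2 * v₂.1.1 1)
    - v₁.1.1 0 * (v₀.1.1 1 * v₂.1.1 2 - v₀.1.1 2 * v₂.1.1 1)
    + v₂.1.1 0 * (v₀.1.1 1 * v₁.1.1 2 - v₀.1.1 2 * v₁.1.1 1))) * hσ

theorem fderiv_cplx {σ a' : ℝ} {a : ℝ → ℝ} {A : F → F →L[ℝ] F} {u : (R3 × F) × ℝ}
    (ha : HasDerivAt a a' u.2) (ha0 : a u.2 ≠ 0) (hA : DifferentiableAt ℝ A u.1.2)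
    (v : (R3 × F) × ℝ) :
    fderiv ℝ (fun z : (R3 × F) × ℝ => cplx σ (a z.2) (A z.1.2)) u v =
      (-a' / a u.2 ^ 2 * v.2) • cplxB F - (a' * v.2) • cplxA F
        + cplxN (fderiv ℝ A u.1.2 v.1.2) := by
  have hN : HasFDerivAt (fun z : (R3 × F) × ℝ => cplxN (A z.1.2))
      (cplxN.comp ((fderiv ℝ A u.1.2).comp toN)) u :=
    HasFDerivAt.comp (g := cplxN) u (ContinuousLinearMap.hasFDerivAt (cplxN (F := F))) (HasFDerivAt.comp (g := A) (f := fun z : (R3 × F) × ℝ => z.1.2) u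
      hA.hasFDerivAt (toN (F := F)).hasFDerivAt)
  have := (((hasFDerivAt_smul_of_hasDerivAt (tim (F := F)) (ha.fun_inv ha0) (cplxB F)).sub
    (hasFDerivAt_smul_of_hasDerivAt (tim (F := F)) ha (cplxA F))).add (hasFDerivAt_const (σ • cplxR F) u)).add hN
  have h2 : fderiv ℝ (fun z : (R3 × F) × ℝ => cplx σ (a z.2) (A z.1.2)) u = _ := this.fderiv
  rw [h2]
  simp

/-- The operator is block diagonal and each block depends only on its own variables: the `(x¹, t)`
block on `t`, the `(x², x³)` block on nothing, the `F` block on the point of `F`. The first block is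
two-dimensional, where the tensor always vanishes; the last one is covered by `hN`. -/
theorem nijenhuisTensor_cplx {σ a' : ℝ} {a : ℝ → ℝ} {A : F → F →L[ℝ] F} {u : (R3 × F) × ℝ}
    (ha : HasDerivAt a a' u.2) (ha0 : a u.2 ≠ 0) (hA : DifferentiableAt ℝ A u.1.2)
    (hN : ∀ ξ ζ, nijenhuisTensor A u.1.2 ξ ζ = 0) (v w : (R3 × F) × ℝ) :
    nijenhuisTensor (fun z : (R3 × F) × ℝ => cplx σ (a z.2) (A z.1.2)) u v w = 0 := by
  have hN' := hN v.1.2 w.1.2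
  rw [nijenhuisTensor] at hN'
  have hD : ∀ x y : (R3 × F) × ℝ,
      ((-a' / a u.2 ^ 2 * x.2) • cplxB F - (a' * x.2) • cplxA F
        + cplxN (fderiv ℝ A u.1.2 x.1.2)) y =
      ((EuclideanSpace.single 0 (-(a' * x.2 * y.2)), fderiv ℝ A u.1.2 x.1.2 y.1.2),
        -a' / a u.2 ^ 2 * x.2 * y.1.1 0) := by
    intro x y
    refine ext_coords ?_ ?_ ?_ ?_ ?_ <;> simp [cplxA, cplxB, cplxN, bas]
  simp only [nijenhuisTensor, fderiv_cplx ha ha0 hA, hD]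
  obtain ⟨h0, h1, h2, h3, h4⟩ := cplx_apply σ (a u.2) (A u.1.2) v
  obtain ⟨k0, k1, k2, k3, k4⟩ := cplx_apply σ (a u.2) (A u.1.2) w
  refine ext_coords ?_ ?_ ?_ ?_ ?_ <;>
    simp only [Prod.fst_add, Prod.snd_add, Prod.fst_sub, Prod.snd_sub, PiLp.add_apply,
      PiLp.sub_apply, (cplx_apply σ (a u.2) (A u.1.2) _).1,
      (cplx_apply σ (a u.2) (A u.1.2) _).2.1, (cplx_apply σ (a u.2) (A u.1.2) _).2.2.1,
      (cplx_apply σ (a u.2) (A u.1.2) _).2.2.2.1, (cplx_apply σ (a u.2) (A u.1.2) _).2.2.2.2]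
  · simp
    field_simp
    ring
  · simp
  · simp
  · simpa using hN'
  · simp
    field_simp
    ring

theorem alternation_fderiv_form {a' s' : ℝ} {a s : ℝ → ℝ} {B : F → F →L[ℝ] F →L[ℝ] ℝ}
    {u : (R3 × F) × ℝ} (ha : HasDerivAt (fun r => (a r)⁻¹) a' u.2) (hs : HasDerivAt s s' u.2)
    (hB : DifferentiableAt ℝ B u.1.2) :
    DifferentiableAt ℝ (fun z : (R3 × F) × ℝ => form (a z.2) (s z.2) (B z.1.2)) u ∧
    ∀ v₀ v₁ v₂ : (R3 × F) × ℝ, fderiv ℝ B u.1.2 v₀.1.2 v₁.1.2 v₂.1.2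
        - fderiv ℝ B u.1.2 v₁.1.2 v₀.1.2 v₂.1.2 + fderiv ℝ B u.1.2 v₂.1.2 v₀.1.2 v₁.1.2 = 0 →
      fderiv ℝ (fun z : (R3 × F) × ℝ => form (a z.2) (s z.2) (B z.1.2)) u v₀ v₁ v₂
        - fderiv ℝ (fun z : (R3 × F) × ℝ => form (a z.2) (s z.2) (B z.1.2)) u v₁ v₀ v₂
        + fderiv ℝ (fun z : (R3 × F) × ℝ => form (a z.2) (s z.2) (B z.1.2)) u v₂ v₀ v₁ =
      s' * volT v₀ v₁ v₂ := by
  have := alternation_fderiv_splitForm (u := u) (crd (F := F)) tim toN ha hs hB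
  simpa only [crd_apply, tim_apply, toN_apply, form, volT] using this

theorem contDiffAt_cplx {σ : ℝ} {a : ℝ → ℝ} {A : F → F →L[ℝ] F} {u : (R3 × F) × ℝ}
    (ha : ContDiffAt ℝ ∞ a u.2) (ha0 : a u.2 ≠ 0) (hA : ContDiffAt ℝ ∞ A u.1.2) :
    ContDiffAt ℝ ∞ (fun z : (R3 × F) × ℝ => cplx σ (a z.2) (A z.1.2)) u := by
  have h1 : ContDiffAt ℝ ∞ (fun z : (R3 × F) × ℝ => a z.2) u := ha.comp u contDiffAt_snd
  have h2 : ContDiffAt ℝ ∞ (fun z : (R3 × F) × ℝ => A z.1.2) u :=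
    hA.comp u (contDiffAt_snd.comp u contDiffAt_fst)
  exact ((((h1.inv ha0).smul contDiffAt_const).sub (h1.smul contDiffAt_const)).add
    contDiffAt_const).add (ContDiffAt.comp (g := cplxN) u
      (ContinuousLinearMap.contDiff (cplxN (F := F))).contDiffAt h2)

theorem contDiffAt_met {a l : ℝ → ℝ} {B : F → F →L[ℝ] F →L[ℝ] ℝ} {u : (R3 × F) × ℝ}
    (ha : ContDiffAt ℝ ∞ a u.2) (ha0 : a u.2 ≠ 0) (hl : ContDiffAt ℝ ∞ l u.2) (hl0 : l u.2 ≠ 0)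
    (hB : ContDiffAt ℝ ∞ B u.1.2) :
    ContDiffAt ℝ ∞ (fun z : (R3 × F) × ℝ => met (a z.2) (l z.2) (B z.1.2)) u := by
  have := contDiffAt_splitMet (u := u) (crd (F := F)) tim toN ha ha0 hl hl0 hB
  simpa only [tim_apply, toN_apply, met] using this

theorem met_symm (a l : ℝ) {B : F →L[ℝ] F →L[ℝ] ℝ} (hB : ∀ ξ ζ, B ξ ζ = B ζ ξ)
    (v w : (R3 × F) × ℝ) : met a l B v w = met a l B w v := by
  rw [met_apply, met_apply, hB]
  ring

theorem met_pos {a l : ℝ} (ha : a ≠ 0) (hl : 0 < l) {B : F →L[ℝ] F →L[ℝ] ℝ}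
    (hB : ∀ ξ, ξ ≠ 0 → 0 < B ξ ξ) {v : (R3 × F) × ℝ} (hv : v ≠ 0) : 0 < met a l B v v := by
  rw [met_apply]
  have hB' : ∀ ξ, 0 ≤ B ξ ξ := fun ξ => by
    rcases eq_or_ne ξ 0 with rfl | h
    · simp
    · exact (hB ξ h).le
  by_contra hle
  have e0 := mul_self_nonneg (a⁻¹ * v.1.1 0)
  have e1 := mul_nonneg (inv_pos.2 hl).le (mul_self_nonneg (v.1.1 1))
  have e2 := mul_nonneg (inv_pos.2 hl).le (mul_self_nonneg (v.1.1 2))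
  have e3 := hB' v.1.2
  have e4 := mul_self_nonneg v.2
  refine hv (ext_coords ?_ ?_ ?_ ?_ ?_)
  · have : a⁻¹ * v.1.1 0 = 0 := mul_self_eq_zero.1 (by linarith)
    simpa [ha] using this
  · have : l⁻¹ * (v.1.1 1 * v.1.1 1) = 0 := by linarith
    simpa [hl.ne'] using this
  · have : l⁻¹ * (v.1.1 2 * v.1.1 2) = 0 := by linarith
    simpa [hl.ne'] using this
  · by_contra h
    linarith [hB _ h]
  · exact mul_self_eq_zero.1 (by linarith)

/-- A Riemannian metric on a bundle has to satisfy this boundedness of unit balls; on the factor `N`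
it is inherited from the given metric. -/
theorem isBounded_met {a l : ℝ} (ha : a ≠ 0) (hl : 0 < l) {B : F →L[ℝ] F →L[ℝ] ℝ}
    (hB : ∀ ξ, 0 ≤ B ξ ξ) (hbd : Bornology.IsBounded {ξ : F | B ξ ξ < 1}) :
    Bornology.IsBounded {v : (R3 × F) × ℝ | met a l B v v < 1} := by
  -- The radius comes from the bounds `(x¹)² ≤ a²` and `(x²)² + (x³)² ≤ l`, which hold wherever the
  -- metric is less than `1`.
  have h1 : Bornology.IsBounded (Metric.closedBall (0 : R3) (Real.sqrt (a ^ 2 + l))) :=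
    Metric.isBounded_closedBall
  have h2 : Bornology.IsBounded (Metric.closedBall (0 : ℝ) 1) := Metric.isBounded_closedBall
  refine ((h1.prod hbd).prod h2).subset ?_
  intro v hv
  rw [mem_ofPred_eq, met_apply] at hv
  have e0 := mul_self_nonneg (a⁻¹ * v.1.1 0)
  have e1 := mul_nonneg (inv_pos.2 hl).le (mul_self_nonneg (v.1.1 1))
  have e2 := mul_nonneg (inv_pos.2 hl).le (mul_self_nonneg (v.1.1 2))
  have e3 := hB v.1.2
  have e4 := mul_self_nonneg v.2
  refine ⟨⟨?_, ?_⟩, ?_⟩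
  · rw [mem_closedBall_zero_iff, EuclideanSpace.norm_eq]
    apply Real.sqrt_le_sqrt
    simp only [Fin.sum_univ_three, Real.norm_eq_abs, sq_abs]
    have f0 : v.1.1 0 ^ 2 ≤ a ^ 2 := by
      have : (a⁻¹ * v.1.1 0) * (a⁻¹ * v.1.1 0) ≤ 1 := by linarith
      have h3 : v.1.1 0 ^ 2 = a ^ 2 * ((a⁻¹ * v.1.1 0) * (a⁻¹ * v.1.1 0)) := by field_simp
      rw [h3]
      nlinarith [sq_nonneg a]
    have f1 : v.1.1 1 ^ 2 + v.1.1 2 ^ 2 ≤ l := by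
      have : l⁻¹ * (v.1.1 1 * v.1.1 1 + v.1.1 2 * v.1.1 2) ≤ 1 := by linarith
      rw [inv_mul_le_iff₀ hl] at this
      linarith
    linarith
  · change B v.1.2 v.1.2 < 1
    linarith
  · rw [mem_closedBall_zero_iff, Real.norm_eq_abs, abs_le_one_iff_mul_self_le_one]
    linarith

end SplitModel

/-! ### Charts of the mapping torus -/

namespace MappingTorus

section Chart

variable {Γ : Submodule ℤ R3} [DiscreteTopology Γ]
  {E N : Type*} [NormedAddCommGroup E] [NormedSpace ℝ E] [TopologicalSpace N] [ChartedSpace E N]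
  [T2Space N] [LocallyCompactSpace N]
  (f : (Torus Γ × N) ≃ₘ⟮modelTN E, modelTN E⟯ (Torus Γ × N))

/-- The preimage of a point of the mapping torus that underlies its preferred chart. -/
noncomputable def lift (p : MappingTorus f) : (Torus Γ × N) × ℝ :=
  (mk_surjective f).hasRightInverse.choose p

omit [T2Space N] [LocallyCompactSpace N] in
theorem mk_lift (p : MappingTorus f) : mk f (lift f p) = p :=
  (mk_surjective f).hasRightInverse.choose_spec p

/-- The differential of the quotient map, as an endomorphism of the model space. -/
noncomputable def dmk (y : (Torus Γ × N) × ℝ) : (R3 × E) × ℝ →L[ℝ] (R3 × E) × ℝ :=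
  mfderiv ((modelTN E).prod 𝓘(ℝ, ℝ)) ((modelTN E).prod 𝓘(ℝ, ℝ)) (mk f) y

/-- The derivative at `ξ` of the inverse of the preferred chart at `(x, p, t)`. -/
noncomputable def prodDeriv (p : N) (ξ : E) : (R3 × E) × ℝ →L[ℝ] (R3 × E) × ℝ :=
  ((ContinuousLinearMap.id ℝ R3).prodMap (symmDeriv 𝓘(ℝ, E) p ξ)).prodMap (.id ℝ ℝ)

variable {f} in
theorem mem_target_snd {p : MappingTorus f} {u : (R3 × E) × ℝ}
    (hu : u ∈ (extChartAt ((modelTN E).prod 𝓘(ℝ, ℝ)) p).target) :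
    u.1.1 ∈ (extChartAt 𝓘(ℝ, R3) (lift f p).1.1).target ∧
      u.1.2 ∈ (extChartAt 𝓘(ℝ, E) (lift f p).1.2).target := by
  have h := mem_target_of_quotient (hq := isLocalHomeomorph_mk f) (hs := mk_surjective f) rfl hu
  rw [extChartAt_prod, extChartAt_prod] at h
  exact ⟨h.1.1, h.1.2⟩

/-- The torus coordinate is left as an unspecified `x`, because the split structures depend only on
the point of `N` and on `t`. -/
theorem extChartAt_symm_eq (p : MappingTorus f) (u : (R3 × E) × ℝ) :
    ∃ x : Torus Γ, (extChartAt ((modelTN E).prod 𝓘(ℝ, ℝ)) p).symm u =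
      mk f ((x, (extChartAt 𝓘(ℝ, E) (lift f p).1.2).symm u.1.2), u.2) ∧
      (extChartAt ((modelTN E).prod 𝓘(ℝ, ℝ)) (lift f p)).symm u =
        ((x, (extChartAt 𝓘(ℝ, E) (lift f p).1.2).symm u.1.2), u.2) := by
  have h := congrFun (extChartAt_symm_quotient (I := (modelTN E).prod 𝓘(ℝ, ℝ))
    (hq := isLocalHomeomorph_mk f) (hs := mk_surjective f) rfl p) u
  refine ⟨(extChartAt 𝓘(ℝ, R3) (lift f p).1.1).symm u.1.1, ?_⟩
  have h2 : (extChartAt ((modelTN E).prod 𝓘(ℝ, ℝ)) (lift f p)).symm u =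
        (((extChartAt 𝓘(ℝ, R3) (lift f p).1.1).symm u.1.1,
          (extChartAt 𝓘(ℝ, E) (lift f p).1.2).symm u.1.2), u.2) := by
    rw [extChartAt_prod, extChartAt_prod]
    rfl
  refine ⟨h.trans ?_, h2⟩
  exact congrArg (mk f) h2

theorem extChartAt_self_snd (p : MappingTorus f) :
    (extChartAt ((modelTN E).prod 𝓘(ℝ, ℝ)) p p).1.2 =
      extChartAt 𝓘(ℝ, E) (lift f p).1.2 (lift f p).1.2 ∧
    (extChartAt ((modelTN E).prod 𝓘(ℝ, ℝ)) p p).2 = (lift f p).2 := by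
  have h := extChartAt_self_quotient (I := (modelTN E).prod 𝓘(ℝ, ℝ))
    (hq := isLocalHomeomorph_mk f) (hs := mk_surjective f) rfl p
  rw [h]
  constructor <;> rfl

variable [IsManifold 𝓘(ℝ, E) ∞ N]

theorem contMDiff_mk :
    ContMDiff ((modelTN E).prod 𝓘(ℝ, ℝ)) ((modelTN E).prod 𝓘(ℝ, ℝ)) ∞ (mk f) := by
  refine contMDiff_quotient (hq := isLocalHomeomorph_mk f) (hs := mk_surjective f) rfl
    fun a b hab => ?_
  obtain ⟨n, hn⟩ : ∃ n : ℤ, @HVAdd.hVAdd ℤ (SuspensionCover f) (SuspensionCover f) _ n a = b :=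
    Quotient.exact hab.symm
  exact ⟨_, SuspensionCover.contMDiff_vadd f n, fun z => Quotient.sound ⟨n, rfl⟩, hn⟩

/-- The tangent space at `p` is thereby that of the cover at `lift f p`, so a tensor on the mapping
torus can be defined by evaluating a tensor of the cover at the lift. -/
theorem dmk_lift (p : MappingTorus f) : dmk f (lift f p) = .id ℝ ((R3 × E) × ℝ) :=
  mfderiv_quotient_lift (hq := isLocalHomeomorph_mk f) (hs := mk_surjective f) rfl p

theorem symmDeriv_eq {p : MappingTorus f} {u : (R3 × E) × ℝ}
    (hu : u ∈ (extChartAt ((modelTN E).prod 𝓘(ℝ, ℝ)) p).target) :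
    symmDeriv ((modelTN E).prod 𝓘(ℝ, ℝ)) p u =
      (dmk f ((extChartAt ((modelTN E).prod 𝓘(ℝ, ℝ)) (lift f p)).symm u)).comp
        (prodDeriv (lift f p).1.2 u.1.2) := by
  obtain ⟨h1, h2⟩ := mem_target_snd hu
  have h3 : u.1 ∈ (extChartAt (modelTN E) (lift f p).1).target := by
    rw [extChartAt_prod]
    exact ⟨h1, h2⟩
  have h4 : u.2 ∈ (extChartAt 𝓘(ℝ, ℝ) (lift f p).2).target := by
    rw [extChartAt_model_space_eq_id]
    trivial
  have h5 : symmDeriv ((modelTN E).prod 𝓘(ℝ, ℝ)) (lift f p) u = prodDeriv (lift f p).1.2 u.1.2 := by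
    rw [symmDeriv_prod h3 h4, symmDeriv_prod h1 h2, symmDeriv_model, Torus.symmDeriv_eq_id Γ h1]
    rfl
  rw [symmDeriv_quotient (hq := isLocalHomeomorph_mk f) (hs := mk_surjective f) rfl
    (contMDiff_mk f) hu, ← h5]
  rfl

end Chart

end MappingTorus

/-! ### Pointwise operators on the model space -/

section TangentOperators

variable {E H : Type*} [NormedAddCommGroup E] [NormedSpace ℝ E] [TopologicalSpace H]
  {I : ModelWithCorners ℝ E H} {M : Type*} [TopologicalSpace M] [ChartedSpace H M]

variable (I) in
/-- The differential of a map between manifolds with the same model, as an endomorphism of the model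
space. -/
noncomputable def modelDeriv (φ : M → M) (p : M) : E →L[ℝ] E := mfderiv I I φ p

variable [IsManifold I ∞ M]

/-- A complex structure at a point, as an endomorphism of the model space. -/
def ComplexStructure.endo (J : ComplexStructure I M) (p : M) : E →L[ℝ] E := J.J p

/-- A Riemannian metric at a point, as a bilinear form on the model space. -/
def metricAt (g : RiemMetric I M) (p : M) : E →L[ℝ] E →L[ℝ] ℝ := g.inner p

theorem ComplexStructure.endo_sq (J : ComplexStructure I M) (p : M) (v : E) :
    J.endo p (J.endo p v) = -v := J.sq p v

theorem metricAt_symm (g : RiemMetric I M) (p : M) (v w : E) :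
    metricAt g p v w = metricAt g p w v := g.symm p v w

theorem metricAt_pos (g : RiemMetric I M) (p : M) {v : E} (hv : v ≠ 0) :
    0 < metricAt g p v v := g.pos p v hv

theorem metricAt_endo {J : ComplexStructure I M} {g : RiemMetric I M} (h : IsCompatible I J g)
    (p : M) (v w : E) : metricAt g p (J.endo p v) (J.endo p w) = metricAt g p v w := h p v w

variable {K : KahlerStructure I M} {ψ : M ≃ₘ⟮I, I⟯ M}

theorem KahlerStructure.IsPreservedBy.endo (h : K.IsPreservedBy ψ) (p : M) (v : E) :
    K.cpx.endo (ψ p) (modelDeriv I ψ p v) = modelDeriv I ψ p (K.cpx.endo p v) := (h.1 p v).symm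

/-- The metric is recovered from `ω` and `J`, so a holomorphic map preserving `ω` is an isometry. -/
theorem KahlerStructure.IsPreservedBy.metricAt (h : K.IsPreservedBy ψ) (p : M) (v w : E) :
    metricAt K.metric (ψ p) (modelDeriv I ψ p v) (modelDeriv I ψ p w) = metricAt K.metric p v w := by
  have h1 : ∀ v : E, _root_.metricAt K.metric (ψ p)
      (K.cpx.endo (ψ p) (modelDeriv I ψ p v)) (modelDeriv I ψ p w) =
      _root_.metricAt K.metric p (K.cpx.endo p v) w := fun v =>
    congrArg (fun L : E [⋀^Fin 2]→L[ℝ] ℝ => L ![v, w]) (h.2 p)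
  -- The vector `-Jv` is chosen because `J(-Jv) = v`, which turns invariance of `ω` into invariance
  -- of the metric.
  have h2 := h1 (-K.cpx.endo p v)
  rwa [h.endo, map_neg, K.cpx.endo_sq, neg_neg] at h2

end TangentOperators

/-! ### Invariance under deck transformations and descent -/

namespace MappingTorus

open SplitModel

variable {Γ : Submodule ℤ R3} [DiscreteTopology Γ]
  {E N : Type*} [NormedAddCommGroup E] [NormedSpace ℝ E] [TopologicalSpace N] [ChartedSpace E N]

theorem mk_deck {E H M : Type*} [NormedAddCommGroup E] [NormedSpace ℝ E] [TopologicalSpace H]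
    {I : ModelWithCorners ℝ E H} [TopologicalSpace M] [ChartedSpace H M] (f : M ≃ₘ⟮I, I⟯ M)
    (y : M × ℝ) : mk f (f y.1, y.2 + 1) = mk f y :=
  Quotient.sound ⟨1, by
    change (((f.toEquiv : Equiv.Perm M) ^ (1 : ℤ)) y.1, y.2 + ((1 : ℤ) : ℝ)) = (f y.1, y.2 + 1)
    rw [zpow_one, Int.cast_one]
    rfl⟩

/-- A property of points of the cover that is invariant under the deck transformations holds
everywhere if it holds on a set of representatives. -/
theorem deck_induction {E H M : Type*} [NormedAddCommGroup E] [NormedSpace ℝ E] [TopologicalSpace H]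
    {I : ModelWithCorners ℝ E H} [TopologicalSpace M] [ChartedSpace H M] (f : M ≃ₘ⟮I, I⟯ M)
    {P : M × ℝ → Prop} (hP : ∀ y : M × ℝ, P (f y.1, y.2 + 1) ↔ P y)
    {y z : M × ℝ} (hyz : mk f y = mk f z) (hy : P y) : P z := by
  obtain ⟨n, hn⟩ : ∃ n : ℤ, @HVAdd.hVAdd ℤ (SuspensionCover f) (SuspensionCover f) _ n y = z :=
    Quotient.exact hyz.symm
  -- The same predicate, on the type that carries the `ℤ`-action.
  let Q : SuspensionCover f → Prop := P
  have h1 : ∀ z : SuspensionCover f, Q ((1 : ℤ) +ᵥ z) ↔ Q z := fun z => by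
    have h2 : (1 : ℤ) +ᵥ z = (f z.1, z.2 + 1) := by
      rw [SuspensionCover.vadd_eq, zpow_one, Int.cast_one]
      rfl
    rw [h2]
    exact hP z
  have h2 : ∀ (n : ℤ) (z : SuspensionCover f), Q (n +ᵥ z) ↔ Q z := fun n z => by
    induction n using Int.induction_on with
    | zero => rw [zero_vadd]
    | succ n ih => rw [add_comm, add_vadd, h1, ih]
    | pred n ih => rw [← h1, ← add_vadd, add_sub_cancel, ih]
  have h3 : Q (@HVAdd.hVAdd ℤ (SuspensionCover f) (SuspensionCover f) _ n y) := (h2 n y).2 hy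
  rw [hn] at h3
  exact h3

variable (ρ : Torus Γ ≃ₘ⟮𝓘(ℝ, R3), 𝓘(ℝ, R3)⟯ Torus Γ) (ψ : N ≃ₘ⟮𝓘(ℝ, E), 𝓘(ℝ, E)⟯ N)

/-- The differential of the deck transformation `(x, p, t) ↦ (ρ x, ψ p, t + 1)`. -/
noncomputable def deckDeriv (y : (Torus Γ × N) × ℝ) : (R3 × E) × ℝ →L[ℝ] (R3 × E) × ℝ :=
  ((modelDeriv 𝓘(ℝ, R3) ρ y.1.1).prodMap (modelDeriv 𝓘(ℝ, E) ψ y.1.2)).prodMap (.id ℝ ℝ)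

theorem modelDeriv_surjective {E H M : Type*} [NormedAddCommGroup E] [NormedSpace ℝ E]
    [TopologicalSpace H] {I : ModelWithCorners ℝ E H} [TopologicalSpace M] [ChartedSpace H M]
    (φ : M ≃ₘ⟮I, I⟯ M) (p : M) : Function.Surjective (modelDeriv I φ p) := by
  have h := (φ.mfderivToContinuousLinearEquiv (by simp) p).surjective
  exact h

theorem deckDeriv_surjective (y : (Torus Γ × N) × ℝ) : Function.Surjective (deckDeriv ρ ψ y) := by
  rintro ⟨⟨X, ξ⟩, s⟩
  obtain ⟨X', rfl⟩ := modelDeriv_surjective ρ y.1.1 X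
  obtain ⟨ξ', rfl⟩ := modelDeriv_surjective ψ y.1.2 ξ
  exact ⟨((X', ξ'), s), rfl⟩

variable [IsManifold 𝓘(ℝ, E) ∞ N]

omit [IsManifold 𝓘(ℝ, E) ∞ N] in
theorem hasMFDerivAt_deck (y : (Torus Γ × N) × ℝ) :
    HasMFDerivAt ((modelTN E).prod 𝓘(ℝ, ℝ)) ((modelTN E).prod 𝓘(ℝ, ℝ))
      (fun y : (Torus Γ × N) × ℝ => (ρ.prodCongr ψ y.1, y.2 + 1)) y (deckDeriv ρ ψ y) := by
  have h1 : HasMFDerivAt 𝓘(ℝ, R3) 𝓘(ℝ, R3) ρ y.1.1 (modelDeriv 𝓘(ℝ, R3) ρ y.1.1) :=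
    (ρ.mdifferentiable (by simp) y.1.1).hasMFDerivAt
  have h2 : HasMFDerivAt 𝓘(ℝ, E) 𝓘(ℝ, E) ψ y.1.2 (modelDeriv (E := E) 𝓘(ℝ, E) ψ y.1.2) :=
    (ψ.mdifferentiable (by simp) y.1.2).hasMFDerivAt
  have h3 : HasMFDerivAt 𝓘(ℝ, ℝ) 𝓘(ℝ, ℝ) (fun t : ℝ => t + 1) y.2 (ContinuousLinearMap.id ℝ ℝ) :=
    ((hasFDerivAt_id y.2).add_const 1).hasMFDerivAt
  have h4 : HasMFDerivAt (modelTN E) (modelTN E) (Prod.map ρ ψ) y.1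
      ((modelDeriv 𝓘(ℝ, R3) ρ y.1.1).prodMap (modelDeriv (E := E) 𝓘(ℝ, E) ψ y.1.2)) :=
    h1.prodMap (p := y.1) h2
  refine (h4.prodMap (p := y) h3).congr_mfderiv ?_
  exact congrArg₂ (fun (A : R3 × E →L[ℝ] R3 × E) (B : ℝ →L[ℝ] ℝ) => A.prodMap B)
    h4.mfderiv h3.mfderiv

variable [T2Space N] [LocallyCompactSpace N]

theorem dmk_deck (y : (Torus Γ × N) × ℝ) :
    dmk (ρ.prodCongr ψ) y = (dmk (ρ.prodCongr ψ) (ρ.prodCongr ψ y.1, y.2 + 1)).comp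
      (deckDeriv ρ ψ y) := by
  have h1 : mk (ρ.prodCongr ψ) = mk (ρ.prodCongr ψ) ∘
      (fun y : (Torus Γ × N) × ℝ => (ρ.prodCongr ψ y.1, y.2 + 1)) :=
    funext fun y => (mk_deck _ y).symm
  have h2 := HasMFDerivAt.comp y
    ((contMDiff_mk (ρ.prodCongr ψ)).mdifferentiable (by simp)
      (ρ.prodCongr ψ y.1, y.2 + 1)).hasMFDerivAt (hasMFDerivAt_deck ρ ψ y)
  rw [← h1] at h2
  exact h2.mfderiv

/-- Functions `a`, `l` of `t` for which the split model structure on `(Γ \ ℝ³) × N × ℝ` is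
generalized Kähler and invariant under `(x, p, t) ↦ (ρ x, ψ p, t + 1)`. -/
structure IsInvariantFamily (a l : ℝ → ℝ) (C : ℝ) : Prop where
  smooth_a : ContDiff ℝ ∞ a
  smooth_l : ContDiff ℝ ∞ l
  a_ne_zero (t : ℝ) : a t ≠ 0
  l_pos (t : ℝ) : 0 < l t
  hasDerivAt_inv_l (t : ℝ) : HasDerivAt (fun s => (l s)⁻¹) (C * a t) t
  exists_conformal : ∃ r α β : ℝ, r * (α ^ 2 + β ^ 2) = 1 ∧ (∀ t, a (t + 1) = r * a t) ∧
    (∀ t, l (t + 1) = (α ^ 2 + β ^ 2) * l t) ∧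
    ∀ (x : Torus Γ) (X : R3), modelDeriv 𝓘(ℝ, R3) ρ x X 0 = r * X 0 ∧
      modelDeriv 𝓘(ℝ, R3) ρ x X 1 = α * X 1 - β * X 2 ∧
      modelDeriv 𝓘(ℝ, R3) ρ x X 2 = β * X 1 + α * X 2

variable {ρ ψ} {a l : ℝ → ℝ} {C : ℝ} (h : IsInvariantFamily ρ a l C)
  {K : KahlerStructure 𝓘(ℝ, E) N} (hψ : K.IsPreservedBy ψ)

variable (K a) in
/-- The split complex structures on the cover. -/
noncomputable def coverCplx (σ : ℝ) (y : (Torus Γ × N) × ℝ) : (R3 × E) × ℝ →L[ℝ] (R3 × E) × ℝ :=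
  cplx σ (a y.2) (K.cpx.endo y.1.2)

variable (K a l) in
/-- The split metric on the cover. -/
noncomputable def coverMet (y : (Torus Γ × N) × ℝ) :
    (R3 × E) × ℝ →L[ℝ] (R3 × E) × ℝ →L[ℝ] ℝ :=
  met (a y.2) (l y.2) (metricAt K.metric y.1.2)

-- A similarity of the `(x², x³)` plane commutes with its rotation, and its factor `α² + β²` is
-- absorbed by `l`. The scaling `r` of `x¹` is absorbed by `a`. The determinant is `r(α² + β²) = 1`,
-- and on `N` the map preserves `J` and the metric.
omit [T2Space N] [LocallyCompactSpace N] in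
include h hψ in
theorem deckDeriv_intertwines (y : (Torus Γ × N) × ℝ) :
    (∀ σ v, coverCplx a K σ (ρ.prodCongr ψ y.1, y.2 + 1) (deckDeriv ρ ψ y v) =
      deckDeriv ρ ψ y (coverCplx a K σ y v)) ∧
    (∀ v w, coverMet a l K (ρ.prodCongr ψ y.1, y.2 + 1) (deckDeriv ρ ψ y v) (deckDeriv ρ ψ y w) =
      coverMet a l K y v w) ∧
    ∀ v₀ v₁ v₂, vol (deckDeriv ρ ψ y v₀) (deckDeriv ρ ψ y v₁) (deckDeriv ρ ψ y v₂) =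
      vol v₀ v₁ v₂ := by
  obtain ⟨r, α, β, hr, ha, hl, hρ⟩ := h.exists_conformal
  have hr0 : r ≠ 0 := left_ne_zero_of_mul_eq_one hr
  have hm0 : α ^ 2 + β ^ 2 ≠ 0 := right_ne_zero_of_mul_eq_one hr
  have d0 : ∀ v, (deckDeriv ρ ψ y v).1.1 0 = r * v.1.1 0 := fun v => (hρ y.1.1 v.1.1).1
  have d1 : ∀ v, (deckDeriv ρ ψ y v).1.1 1 = α * v.1.1 1 - β * v.1.1 2 :=
    fun v => (hρ y.1.1 v.1.1).2.1
  have d2 : ∀ v, (deckDeriv ρ ψ y v).1.1 2 = β * v.1.1 1 + α * v.1.1 2 :=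
    fun v => (hρ y.1.1 v.1.1).2.2
  have dN : ∀ v, (deckDeriv ρ ψ y v).1.2 = modelDeriv 𝓘(ℝ, E) ψ y.1.2 v.1.2 := fun v => rfl
  have dt : ∀ v, (deckDeriv ρ ψ y v).2 = v.2 := fun v => rfl
  refine ⟨fun σ v => ?_, fun v w => ?_, fun v₀ v₁ v₂ => ?_⟩
  · obtain ⟨h0, h1, h2, h3, h4⟩ := cplx_apply σ (a y.2) (K.cpx.endo y.1.2) v
    obtain ⟨k0, k1, k2, k3, k4⟩ := cplx_apply σ (a (y.2 + 1)) (K.cpx.endo (ψ y.1.2))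
      (deckDeriv ρ ψ y v)
    refine ext_coords ?_ ?_ ?_ ?_ ?_
    · rw [d0]
      refine k0.trans ?_
      rw [coverCplx, h0, dt, ha]
      ring
    · rw [d1]
      refine k1.trans ?_
      rw [coverCplx, h1, h2, d2]
      ring
    · rw [d2]
      refine k2.trans ?_
      rw [coverCplx, h1, h2, d1]
      ring
    · rw [dN]
      refine k3.trans ?_
      rw [coverCplx, h3, dN, hψ.endo]
    · rw [dt]
      refine k4.trans ?_
      rw [coverCplx, h4, ha, d0]
      field_simp
  · refine (met_apply (a (y.2 + 1)) (l (y.2 + 1)) (metricAt K.metric (ψ y.1.2)) _ _).trans ?_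
    rw [coverMet, met_apply, d0, d0, d1, d1, d2, d2, dN, dN, dt, dt, hψ.metricAt, ha, hl]
    have := h.a_ne_zero y.2
    have := (h.l_pos y.2).ne'
    field_simp
    ring
  · simp only [vol, d0, d1, d2]
    linear_combination (v₀.1.1 0 * (v₁.1.1 1 * v₂.1.1 2 - v₁.1.1 2 * v₂.1.1 1)
      - v₁.1.1 0 * (v₀.1.1 1 * v₂.1.1 2 - v₀.1.1 2 * v₂.1.1 1)
      + v₂.1.1 0 * (v₀.1.1 1 * v₁.1.1 2 - v₀.1.1 2 * v₁.1.1 1)) * hr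

include h hψ in
/-- The split structures on the cover are pulled back from the mapping torus. -/
theorem dmk_intertwines (y : (Torus Γ × N) × ℝ) :
    (∀ σ v, coverCplx a K σ (lift (ρ.prodCongr ψ) (mk (ρ.prodCongr ψ) y))
        (dmk (ρ.prodCongr ψ) y v) = dmk (ρ.prodCongr ψ) y (coverCplx a K σ y v)) ∧
    (∀ v w, coverMet a l K (lift (ρ.prodCongr ψ) (mk (ρ.prodCongr ψ) y))
        (dmk (ρ.prodCongr ψ) y v) (dmk (ρ.prodCongr ψ) y w) = coverMet a l K y v w) ∧
    ∀ v₀ v₁ v₂, vol (dmk (ρ.prodCongr ψ) y v₀) (dmk (ρ.prodCongr ψ) y v₁)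
      (dmk (ρ.prodCongr ψ) y v₂) = vol v₀ v₁ v₂ := by
  -- At the lift of a point the differential of the quotient map is the identity and all three
  -- claims are trivial; deck invariance carries them along the fibre to `y`.
  refine deck_induction (ρ.prodCongr ψ) (P := fun y =>
    (∀ σ v, coverCplx a K σ (lift (ρ.prodCongr ψ) (mk (ρ.prodCongr ψ) y))
        (dmk (ρ.prodCongr ψ) y v) = dmk (ρ.prodCongr ψ) y (coverCplx a K σ y v)) ∧
    (∀ v w, coverMet a l K (lift (ρ.prodCongr ψ) (mk (ρ.prodCongr ψ) y))
        (dmk (ρ.prodCongr ψ) y v) (dmk (ρ.prodCongr ψ) y w) = coverMet a l K y v w) ∧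
    ∀ v₀ v₁ v₂, vol (dmk (ρ.prodCongr ψ) y v₀) (dmk (ρ.prodCongr ψ) y v₁)
      (dmk (ρ.prodCongr ψ) y v₂) = vol v₀ v₁ v₂) (fun z => ?_)
    (mk_lift (ρ.prodCongr ψ) (mk (ρ.prodCongr ψ) y)) ?_
  · obtain ⟨h1, h2, h3⟩ := deckDeriv_intertwines h hψ z
    have hs := deckDeriv_surjective ρ ψ z
    have hd : ∀ v, dmk (ρ.prodCongr ψ) (ρ.prodCongr ψ z.1, z.2 + 1) (deckDeriv ρ ψ z v) =
        dmk (ρ.prodCongr ψ) z v := fun v =>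
      congrArg (fun L : (R3 × E) × ℝ →L[ℝ] (R3 × E) × ℝ => L v) (dmk_deck ρ ψ z).symm
    rw [mk_deck]
    -- As `deckDeriv` is surjective, vectors at the translated point may be taken in its image,
    -- where the chain rule `hd` and the invariance on the cover apply.
    refine and_congr (forall_congr' fun σ => hs.forall.trans (forall_congr' fun v => ?_))
      (and_congr (hs.forall.trans (forall_congr' fun v => hs.forall.trans
        (forall_congr' fun w => ?_))) (hs.forall.trans (forall_congr' fun v₀ => hs.forall.trans
        (forall_congr' fun v₁ => hs.forall.trans (forall_congr' fun v₂ => ?_)))))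
    · rw [h1, hd, hd]
    · rw [h2, hd, hd]
    · rw [h3, hd, hd, hd]
  · rw [mk_lift, dmk_lift]
    exact ⟨fun _ _ => rfl, fun _ _ => rfl, fun _ _ _ => rfl⟩

end MappingTorus

/-! ### Fundamental forms and `d^c` in charts -/

section FundamentalForm

variable {E H : Type*} [NormedAddCommGroup E] [NormedSpace ℝ E] [TopologicalSpace H]
  {I : ModelWithCorners ℝ E H} {M : Type*} [TopologicalSpace M] [ChartedSpace H M]
  [IsManifold I ∞ M]

theorem EndField.inChart_eq {J : EndField I M} {p : M} {u : E} (hu : u ∈ (extChartAt I p).target)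
    {A : E →L[ℝ] E} (hA : (symmDeriv I p u).comp A =
      (show E →L[ℝ] E from J ((extChartAt I p).symm u)).comp (symmDeriv I p u)) :
    J.inChart I p u = A := by
  rw [EndField.inChart, ← hA, ← ContinuousLinearMap.comp_assoc, chartDeriv_comp_symmDeriv hu,
    ContinuousLinearMap.id_comp]

theorem fundamentalForm_inChart {J : ComplexStructure I M} {g : RiemMetric I M}
    (h : IsCompatible I J g) {p : M} {u : E} (hu : u ∈ (extChartAt I p).target) (v : Fin 2 → E) :
    (fundamentalForm I h).inChart I p u v =
      ((bilinInChart I g.inner p u).comp (J.J.inChart I p u)) (v 0) (v 1) :=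
  congrArg (fun w : E => metricAt g ((extChartAt I p).symm u) w (symmDeriv I p u (v 1)))
    (congrArg (fun L : E →L[ℝ] E => L (v 0)) (symmDeriv_inChart J.J hu)).symm

/-- The form is of type `(1,1)`. Hence `d^c ω` is `dω` evaluated on the vectors `-J v`. -/
theorem act_fundamentalForm {J : ComplexStructure I M} {g : RiemMetric I M}
    (h : IsCompatible I J g) :
    DiffForm.act I J.J (fundamentalForm I h) = fundamentalForm I h := by
  funext p
  ext v
  exact h p (J.J p (v 0)) (v 1)

omit [IsManifold I ∞ M] in
theorem bilinInChart_apply (g : M → E →L[ℝ] E →L[ℝ] ℝ) (p : M) (u v w : E) :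
    bilinInChart I g p u v w =
      g ((extChartAt I p).symm u) (symmDeriv I p u v) (symmDeriv I p u w) := rfl

/-- The value of a differential form at a point, as a form on the model space. -/
def DiffForm.formAt {n : ℕ} (α : DiffForm I M n) (p : M) : E [⋀^Fin n]→L[ℝ] ℝ := α p

theorem dc_fundamentalForm {J : ComplexStructure I M} {g : RiemMetric I M}
    (h : IsCompatible I J g) (p : M) (v : Fin 3 → E) :
    (DiffForm.dc I J.J (fundamentalForm I h)).formAt p v =
      (DiffForm.d I (fundamentalForm I h)).formAt p (fun i => -J.endo p (v i)) :=
  congrArg (fun α : DiffForm I M 2 => (DiffForm.d I α).formAt p (fun i => -J.endo p (v i)))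
    (act_fundamentalForm h)

theorem nijenhuisTensor_congr {A B : E → E →L[ℝ] E} {u : E} (h : A =ᶠ[𝓝 u] B) (v w : E) :
    nijenhuisTensor A u v w = nijenhuisTensor B u v w := by
  rw [nijenhuisTensor, nijenhuisTensor, h.fderiv_eq, h.eq_of_nhds]

variable [I.Boundaryless]

theorem differentiableAt_bilinInChart_comp (J : ComplexStructure I M) (g : RiemMetric I M) (p : M) :
    DifferentiableAt ℝ (fun u => (bilinInChart I g.inner p u).comp (J.J.inChart I p u))
      (extChartAt I p p) :=
  DifferentiableAt.clm_comp
    (((contMDiffAt_bilin_iff g.inner p).1 (g.contMDiff p)).differentiableAt (by simp))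
    (J.differentiableAt_inChart p)

/-- Closedness of `ω` in a chart of `N`, in the form demanded by `alternation_fderiv_form`. -/
theorem KahlerStructure.alternation_fderiv (K : KahlerStructure I M) (p : M) (v₀ v₁ v₂ : E) :
    fderiv ℝ (fun u => (bilinInChart I K.metric.inner p u).comp (K.cpx.J.inChart I p u))
        (extChartAt I p p) v₀ v₁ v₂
      - fderiv ℝ (fun u => (bilinInChart I K.metric.inner p u).comp (K.cpx.J.inChart I p u))
        (extChartAt I p p) v₁ v₀ v₂
      + fderiv ℝ (fun u => (bilinInChart I K.metric.inner p u).comp (K.cpx.J.inChart I p u))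
        (extChartAt I p p) v₂ v₀ v₁ = 0 := by
  have h := DiffForm.d_apply_of_bilin (fundamentalForm I K.compat) p _
    (differentiableAt_bilinInChart_comp K.cpx K.metric p)
    ((eventually_mem_target p).mono fun u hu => fundamentalForm_inChart K.compat hu) ![v₀, v₁, v₂]
  rw [K.closed] at h
  exact h.symm

end FundamentalForm

/-! ### The split generalized Kähler structure on the mapping torus -/

namespace MappingTorus

open SplitModel

variable {Γ : Submodule ℤ R3} [DiscreteTopology Γ]
  {E N : Type*} [NormedAddCommGroup E] [NormedSpace ℝ E] [TopologicalSpace N] [ChartedSpace E N]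
  [IsManifold 𝓘(ℝ, E) ∞ N] [T2Space N] [LocallyCompactSpace N]
  {ρ : Torus Γ ≃ₘ⟮𝓘(ℝ, R3), 𝓘(ℝ, R3)⟯ Torus Γ} {ψ : N ≃ₘ⟮𝓘(ℝ, E), 𝓘(ℝ, E)⟯ N}
  {a l : ℝ → ℝ} {C : ℝ} (h : IsInvariantFamily ρ a l C)
  {K : KahlerStructure 𝓘(ℝ, E) N} (hψ : K.IsPreservedBy ψ)

variable (ρ ψ a K) in
/-- The split almost complex structures on the mapping torus. -/
noncomputable def cplxField (σ : ℝ) :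
    EndField ((modelTN E).prod 𝓘(ℝ, ℝ)) (MappingTorus (ρ.prodCongr ψ)) :=
  fun p => coverCplx a K σ (lift _ p)

variable (ρ ψ a l K) in
/-- The split metric on the mapping torus. -/
noncomputable def metField (p : MappingTorus (ρ.prodCongr ψ)) :
    TangentSpace ((modelTN E).prod 𝓘(ℝ, ℝ)) p →L[ℝ]
      TangentSpace ((modelTN E).prod 𝓘(ℝ, ℝ)) p →L[ℝ] ℝ :=
  coverMet a l K (lift _ p)

omit [DiscreteTopology Γ] [T2Space N] [LocallyCompactSpace N] in
theorem prodDeriv_cplx (σ t : ℝ) (x : Torus Γ) {p : N} {ξ : E}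
    (hξ : ξ ∈ (extChartAt 𝓘(ℝ, E) p).target) (v : (R3 × E) × ℝ) :
    prodDeriv p ξ (cplx σ (a t) (K.cpx.J.inChart 𝓘(ℝ, E) p ξ) v) =
      coverCplx a K σ ((x, (extChartAt 𝓘(ℝ, E) p).symm ξ), t) (prodDeriv p ξ v) := by
  obtain ⟨h0, h1, h2, h3, h4⟩ := cplx_apply σ (a t) (K.cpx.J.inChart 𝓘(ℝ, E) p ξ) v
  obtain ⟨k0, k1, k2, k3, k4⟩ := cplx_apply σ (a t) (K.cpx.endo ((extChartAt 𝓘(ℝ, E) p).symm ξ))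
    (prodDeriv p ξ v)
  refine ext_coords (h0.trans k0.symm) (h1.trans k1.symm) (h2.trans k2.symm) ?_ (h4.trans k4.symm)
  refine Eq.trans ?_ k3.symm
  refine (congrArg (symmDeriv 𝓘(ℝ, E) p ξ) h3).trans ?_
  exact congrArg (fun L : E →L[ℝ] E => L v.1.2) (symmDeriv_inChart K.cpx.J hξ)

omit [DiscreteTopology Γ] [T2Space N] [LocallyCompactSpace N] in
theorem coverMet_prodDeriv (t : ℝ) (x : Torus Γ) (p : N) (ξ : E) (v w : (R3 × E) × ℝ) :
    coverMet a l K ((x, (extChartAt 𝓘(ℝ, E) p).symm ξ), t) (prodDeriv p ξ v) (prodDeriv p ξ w) =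
      met (a t) (l t) (bilinInChart 𝓘(ℝ, E) K.metric.inner p ξ) v w := by
  refine (met_apply (a t) (l t) (metricAt K.metric ((extChartAt 𝓘(ℝ, E) p).symm ξ)) _ _).trans ?_
  exact (met_apply (a t) (l t) (bilinInChart 𝓘(ℝ, E) K.metric.inner p ξ) v w).symm

include h hψ

/-- The inverse chart is the quotient map after a product chart, and both intertwine the structures.
Every local question about the mapping torus is thereby reduced to the model `cplx`, with `J` read
in a chart of `N`. -/
theorem cplxField_inChart (σ : ℝ) {p : MappingTorus (ρ.prodCongr ψ)} {u : (R3 × E) × ℝ}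
    (hu : u ∈ (extChartAt ((modelTN E).prod 𝓘(ℝ, ℝ)) p).target) :
    (cplxField ρ ψ a K σ).inChart ((modelTN E).prod 𝓘(ℝ, ℝ)) p u =
      cplx σ (a u.2) (K.cpx.J.inChart 𝓘(ℝ, E) (lift _ p).1.2 u.1.2) := by
  refine EndField.inChart_eq hu ?_
  obtain ⟨x, hx, hy⟩ := extChartAt_symm_eq _ p u
  rw [symmDeriv_eq _ hu, hy]
  refine ContinuousLinearMap.ext fun v => ?_
  refine (congrArg (dmk _ _) (prodDeriv_cplx σ u.2 x (mem_target_snd hu).2 v)).trans ?_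
  refine ((dmk_intertwines h hψ _).1 σ _).symm.trans ?_
  rw [hx]
  rfl

theorem metField_inChart {p : MappingTorus (ρ.prodCongr ψ)} {u : (R3 × E) × ℝ}
    (hu : u ∈ (extChartAt ((modelTN E).prod 𝓘(ℝ, ℝ)) p).target) :
    bilinInChart ((modelTN E).prod 𝓘(ℝ, ℝ)) (metField ρ ψ a l K) p u =
      met (a u.2) (l u.2) (bilinInChart 𝓘(ℝ, E) K.metric.inner (lift _ p).1.2 u.1.2) := by
  obtain ⟨x, hx, hy⟩ := extChartAt_symm_eq _ p u
  have hs := symmDeriv_eq _ hu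
  rw [hy] at hs
  refine ContinuousLinearMap.ext fun v => ContinuousLinearMap.ext fun w => ?_
  refine (bilinInChart_apply (fun p => coverMet a l K (lift (ρ.prodCongr ψ) p)) p u v w).trans ?_
  rw [hs, hx, ContinuousLinearMap.comp_apply, ContinuousLinearMap.comp_apply,
    (dmk_intertwines h hψ _).2.1]
  exact coverMet_prodDeriv u.2 x _ _ v w

/-- The split Riemannian metric on the mapping torus. -/
noncomputable def splitMetric :
    RiemMetric ((modelTN E).prod 𝓘(ℝ, ℝ)) (MappingTorus (ρ.prodCongr ψ)) where
  inner := metField ρ ψ a l K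
  symm p v w := met_symm _ _ (metricAt_symm K.metric _) v w
  pos p v hv := met_pos (h.a_ne_zero _) (h.l_pos _) (fun _ => metricAt_pos K.metric _) hv
  isVonNBounded p := (NormedSpace.isVonNBounded_iff (E := (R3 × E) × ℝ) ℝ).2
    (isBounded_met (h.a_ne_zero _) (h.l_pos _)
      (fun ξ => by
        rcases eq_or_ne ξ 0 with rfl | hξ
        · rw [map_zero]
        · exact (metricAt_pos K.metric _ hξ).le)
      ((NormedSpace.isVonNBounded_iff (E := E) ℝ).1 (K.metric.isVonNBounded _)))
  contMDiff p := by
    refine (contMDiffAt_bilin_iff _ p).2 ?_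
    refine ContDiffAt.congr_of_eventuallyEq ?_
      ((eventually_mem_target p).mono fun _ hu => metField_inChart h hψ hu)
    refine contDiffAt_met h.smooth_a.contDiffAt (h.a_ne_zero _) h.smooth_l.contDiffAt
      (h.l_pos _).ne' ?_
    rw [(extChartAt_self_snd _ p).1]
    exact (contMDiffAt_bilin_iff K.metric.inner _).1 (K.metric.contMDiff _)

variable [CompleteSpace E]

/-- The split complex structures on the mapping torus. -/
noncomputable def cplxStructure {σ : ℝ} (hσ : σ * σ = 1) :
    ComplexStructure ((modelTN E).prod 𝓘(ℝ, ℝ)) (MappingTorus (ρ.prodCongr ψ)) :=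
  have hev : ∀ p, (cplxField ρ ψ a K σ).inChart ((modelTN E).prod 𝓘(ℝ, ℝ)) p
      =ᶠ[𝓝 (extChartAt ((modelTN E).prod 𝓘(ℝ, ℝ)) p p)] fun u : (R3 × E) × ℝ =>
        cplx σ (a u.2) (K.cpx.J.inChart 𝓘(ℝ, E) (lift (ρ.prodCongr ψ) p).1.2 u.1.2) := fun p =>
    (eventually_mem_target p).mono fun _ hu => cplxField_inChart h hψ σ hu
  have hsm : ∀ p, ContDiffAt ℝ ∞ ((cplxField ρ ψ a K σ).inChart ((modelTN E).prod 𝓘(ℝ, ℝ)) p)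
      (extChartAt ((modelTN E).prod 𝓘(ℝ, ℝ)) p p) := fun p => by
    refine ContDiffAt.congr_of_eventuallyEq ?_ (hev p)
    refine contDiffAt_cplx h.smooth_a.contDiffAt (h.a_ne_zero _) ?_
    rw [(extChartAt_self_snd _ p).1]
    exact (contMDiffAt_endField_iff K.cpx.J _).1 (K.cpx.smooth _)
  have hsq : ∀ p (X : (R3 × E) × ℝ), coverCplx a K σ (lift (ρ.prodCongr ψ) p)
      (coverCplx a K σ (lift (ρ.prodCongr ψ) p) X) = -X := fun p X =>
    cplx_sq hσ (h.a_ne_zero _) (K.cpx.endo_sq _ _)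
  { J := cplxField ρ ψ a K σ
    smooth := fun p => (contMDiffAt_endField_iff _ p).2 (hsm p)
    sq := hsq
    integrable := fun p X Y hX hY => by
      refine (nijenhuis_eq_nijenhuisTensor ((hsm p).differentiableAt (by simp)) (hsq p)
        hX hY).trans ((nijenhuisTensor_congr (hev p) _ _).trans ?_)
      have := h.smooth_a.differentiable (by simp)
      refine nijenhuisTensor_cplx (σ := σ) (u := extChartAt ((modelTN E).prod 𝓘(ℝ, ℝ)) p p)
        (this _).hasDerivAt (h.a_ne_zero _) ?_ ?_ (X p) (Y p)
      · rw [(extChartAt_self_snd _ p).1]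
        exact K.cpx.differentiableAt_inChart _
      · rw [(extChartAt_self_snd _ p).1]
        exact K.cpx.nijenhuisTensor_eq_zero _ }

theorem isCompatible_split {σ : ℝ} (hσ : σ * σ = 1) :
    IsCompatible ((modelTN E).prod 𝓘(ℝ, ℝ)) (cplxStructure h hψ hσ) (splitMetric h hψ) :=
  fun _ _ _ => met_cplx_cplx hσ (h.a_ne_zero _) _ (metricAt_endo K.compat _ _ _)

/-- In a chart the form is `a⁻¹ dx¹ ∧ dt + σ l⁻¹ dx² ∧ dx³ + ω` with `ω` closed, and `(l⁻¹)' = C a`.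
-/
theorem d_fundamentalForm_apply {σ : ℝ} (hσ : σ * σ = 1) (p : MappingTorus (ρ.prodCongr ψ))
    (v : Fin 3 → (R3 × E) × ℝ) :
    (DiffForm.d _ (fundamentalForm _ (isCompatible_split h hψ hσ))).formAt p v =
      σ * (C * a (lift _ p).2) * volT (v 0) (v 1) (v 2) := by
  obtain ⟨e1, e2⟩ := extChartAt_self_snd _ p
  have hdi := h.smooth_a.differentiable (by simp)
  have h1 := alternation_fderiv_form
    (u := (show (R3 × E) × ℝ from extChartAt ((modelTN E).prod 𝓘(ℝ, ℝ)) p p))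
    ((hdi _).hasDerivAt.inv (h.a_ne_zero _)) ((h.hasDerivAt_inv_l _).const_mul σ)
    (B := fun ξ => (bilinInChart 𝓘(ℝ, E) K.metric.inner (lift _ p).1.2 ξ).comp
      (K.cpx.J.inChart 𝓘(ℝ, E) (lift _ p).1.2 ξ)) (by
      rw [e1]
      exact differentiableAt_bilinInChart_comp K.cpx K.metric _)
  refine (DiffForm.d_apply_of_bilin _ p _ h1.1 ?_ v).trans ((h1.2 _ _ _ ?_).trans ?_)
  rotate_left
  · rw [e1]
    exact K.alternation_fderiv _ _ _ _
  · rw [e2]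
  · filter_upwards [eventually_mem_target p] with u hu w
    rw [fundamentalForm_inChart (isCompatible_split h hψ hσ) hu]
    rw [ContinuousLinearMap.comp_apply]
    refine (congrArg₂ (fun (B : (R3 × E) × ℝ →L[ℝ] (R3 × E) × ℝ →L[ℝ] ℝ)
      (A : (R3 × E) × ℝ →L[ℝ] (R3 × E) × ℝ) => B (A (w 0)) (w 1)) (metField_inChart h hψ hu)
      (cplxField_inChart h hψ σ hu)).trans ?_
    exact met_cplx_left (h.a_ne_zero _) σ _ _ _ _ _

/-- The factor `a` of `dω` cancels against the `a⁻¹` of `volT_neg_cplx`. The result is linear in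
`σ`, which gives the opposite signs of `d^c_± ω_±`. -/
theorem dc_fundamentalForm_apply {σ : ℝ} (hσ : σ * σ = 1) (p : MappingTorus (ρ.prodCongr ψ))
    (v : Fin 3 → (R3 × E) × ℝ) :
    (DiffForm.dc _ (cplxStructure h hψ hσ).J
      (fundamentalForm _ (isCompatible_split h hψ hσ))).formAt p v =
      -(σ * C * vol (v 0) (v 1) (v 2)) := by
  rw [dc_fundamentalForm]
  refine (d_fundamentalForm_apply h hψ hσ p _).trans ?_
  refine (congrArg _ (volT_neg_cplx hσ (a (lift _ p).2) (K.cpx.endo (lift _ p).1.2) _ _ _)).trans ?_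
  have := h.a_ne_zero (lift _ p).2
  field_simp

/-- A multiple of `dx¹ ∧ dx² ∧ dx³` by a constant has constant coefficients in every preferred
chart, since the quotient map preserves `vol` and the product charts do not touch the torus
directions. -/
theorem d_dc_fundamentalForm {σ : ℝ} (hσ : σ * σ = 1) :
    DiffForm.d _ (DiffForm.dc _ (cplxStructure h hψ hσ).J
      (fundamentalForm _ (isCompatible_split h hψ hσ))) = 0 := by
  have key : ∀ p : MappingTorus (ρ.prodCongr ψ), ∀ u : (R3 × E) × ℝ,
      u ∈ (extChartAt ((modelTN E).prod 𝓘(ℝ, ℝ)) p).target → ∀ v,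
      (DiffForm.dc _ (cplxStructure h hψ hσ).J
        (fundamentalForm _ (isCompatible_split h hψ hσ))).inChart _ p u v =
      -(σ * C * vol (v 0) (v 1) (v 2)) := fun p u hu v => by
    obtain ⟨x, hx, hy⟩ := extChartAt_symm_eq _ p u
    rw [DiffForm.inChart_apply, symmDeriv_eq _ hu, hy]
    refine (dc_fundamentalForm_apply h hψ hσ _ _).trans ?_
    exact congrArg (fun r => -(σ * C * r)) ((dmk_intertwines h hψ _).2.2 _ _ _)
  funext p
  refine DiffForm.d_eq_zero_of_eventually_const _ p ((DiffForm.dc _ (cplxStructure h hψ hσ).J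
    (fundamentalForm _ (isCompatible_split h hψ hσ))).inChart _ p
      (extChartAt ((modelTN E).prod 𝓘(ℝ, ℝ)) p p))
    ((eventually_mem_target p).mono fun u hu => ContinuousAlternatingMap.ext fun v => ?_)
  rw [key p u hu, key p _ (mem_extChartAt_target p)]

/-- The split generalized Kähler structure on the mapping torus. -/
noncomputable def splitStructure :
    GenKahlerStructure ((modelTN E).prod 𝓘(ℝ, ℝ)) (MappingTorus (ρ.prodCongr ψ)) where
  cpxPlus := cplxStructure h hψ (mul_one 1)
  cpxMinus := cplxStructure h hψ (σ := -1) (by norm_num)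
  metric := splitMetric h hψ
  compatPlus := isCompatible_split h hψ _
  compatMinus := isCompatible_split h hψ _
  dc_eq := by
    funext p
    refine ContinuousAlternatingMap.ext fun v => ?_
    refine (dc_fundamentalForm_apply h hψ (mul_one 1) p v).trans ?_
    refine Eq.trans ?_ (congrArg Neg.neg
      (dc_fundamentalForm_apply h hψ (σ := -1) (by norm_num) p v)).symm
    ring
  closed := d_dc_fundamentalForm h hψ _

theorem isSplit_splitStructure : (splitStructure h hψ).IsSplit :=
  fun _ _ => cplx_comm _ _ _ _ _

end MappingTorus

/-! ### From the frame coefficients to an invariant family -/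

namespace FrameCoeffs

variable (c : FrameCoeffs) (Γ : Submodule ℤ R3) [DiscreteTopology Γ]

/-- The coframe at a point of the torus, as covectors on `ℝ³`. -/
noncomputable def coframeAt (t : ℝ) (x : Torus Γ) (i : Fin 3) : R3 →L[ℝ] ℝ := c.coframe Γ t x i

/-- The frame at a point of the torus, as vectors of `ℝ³`. -/
noncomputable def frameAt (t : ℝ) (x : Torus Γ) (i : Fin 3) : R3 := c.frame Γ t x i

theorem coframeAt_apply (t : ℝ) (x : Torus Γ) (X : R3) :
    c.coframeAt Γ t x 0 X = 1 / c.a₁ t * X 0 ∧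
    c.coframeAt Γ t x 1 X = c.b₂ t / c.l t * X 1 + c.b₃ t / c.l t * X 2 ∧
    c.coframeAt Γ t x 2 X = -(c.b₃ t / c.l t) * X 1 + c.b₂ t / c.l t * X 2 := by
  have h : ∀ i, (show R3 →L[ℝ] ℝ from Torus.dx Γ i x) X = X i := fun i =>
    congrArg (fun L : R3 →L[ℝ] ℝ => L X) (Torus.dx_eq Γ i x)
  have h0 : c.coframeAt Γ t x 0 = (1 / c.a₁ t) • (show R3 →L[ℝ] ℝ from Torus.dx Γ 0 x) := rfl
  have h1 : c.coframeAt Γ t x 1 = (c.b₂ t / c.l t) • (show R3 →L[ℝ] ℝ from Torus.dx Γ 1 x)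
    + (c.b₃ t / c.l t) • (show R3 →L[ℝ] ℝ from Torus.dx Γ 2 x) := rfl
  have h2 : c.coframeAt Γ t x 2 = -(c.b₃ t / c.l t) • (show R3 →L[ℝ] ℝ from Torus.dx Γ 1 x)
    + (c.b₂ t / c.l t) • (show R3 →L[ℝ] ℝ from Torus.dx Γ 2 x) := rfl
  refine ⟨?_, ?_, ?_⟩
  · rw [h0, smul_apply, h, smul_eq_mul]
  · rw [h1, add_apply, smul_apply, smul_apply, h, h, smul_eq_mul, smul_eq_mul]
  · rw [h2, add_apply, smul_apply, smul_apply, h, h, smul_eq_mul, smul_eq_mul]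

theorem frameAt_eq (t : ℝ) (x : Torus Γ) :
    c.frameAt Γ t x 0 = !₂[c.a₁ t, 0, 0] ∧ c.frameAt Γ t x 1 = !₂[0, c.b₂ t, c.b₃ t] ∧
      c.frameAt Γ t x 2 = !₂[0, -c.b₃ t, c.b₂ t] := by
  have h0 : c.frameAt Γ t x 0 = c.a₁ t • (show R3 from Torus.dd Γ 0 x) := rfl
  have h1 : c.frameAt Γ t x 1 = c.b₂ t • (show R3 from Torus.dd Γ 1 x)
    + c.b₃ t • (show R3 from Torus.dd Γ 2 x) := rfl
  have h2 : c.frameAt Γ t x 2 = -c.b₃ t • (show R3 from Torus.dd Γ 1 x)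
    + c.b₂ t • (show R3 from Torus.dd Γ 2 x) := rfl
  rw [Torus.dd_eq] at h0
  rw [Torus.dd_eq, Torus.dd_eq] at h1 h2
  rw [h0, h1, h2]
  refine ⟨?_, ?_, ?_⟩ <;> ext i <;> fin_cases i <;> simp

variable {c Γ} {ρ : Torus Γ ≃ₘ⟮𝓘(ℝ, R3), 𝓘(ℝ, R3)⟯ Torus Γ}

theorem PullsBack.coframeAt {t s : ℝ} (h : c.PullsBack Γ ρ t s) (x : Torus Γ) (i : Fin 3) (X : R3) :
    c.coframeAt Γ t (ρ x) i (modelDeriv 𝓘(ℝ, R3) ρ x X) = c.coframeAt Γ s x i X :=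
  congrArg (fun L : R3 →L[ℝ] ℝ => L X) (h i x)

/-- The differential of `ρ` carries the frame at time `s` to the frame at time `t`. With `b = b₂ + i
b₃` and the `(x², x³)` plane viewed as `ℂ`, the frame vectors are `b` and `i b`, so the differential
is multiplication by `b(t)/b(s) = b(t) conj(b(s)) / l(s)`. -/
theorem PullsBack.modelDeriv_apply {t s : ℝ} (h : c.PullsBack Γ ρ t s) (ha : c.a₁ t ≠ 0)
    (hl : c.l t ≠ 0) (x : Torus Γ) (X : R3) :
    modelDeriv 𝓘(ℝ, R3) ρ x X 0 = c.a₁ t / c.a₁ s * X 0 ∧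
    modelDeriv 𝓘(ℝ, R3) ρ x X 1 = (c.b₂ t * c.b₂ s + c.b₃ t * c.b₃ s) / c.l s * X 1
      - (c.b₃ t * c.b₂ s - c.b₂ t * c.b₃ s) / c.l s * X 2 ∧
    modelDeriv 𝓘(ℝ, R3) ρ x X 2 = (c.b₃ t * c.b₂ s - c.b₂ t * c.b₃ s) / c.l s * X 1
      + (c.b₂ t * c.b₂ s + c.b₃ t * c.b₃ s) / c.l s * X 2 := by
  obtain ⟨p0, p1, p2⟩ := c.coframeAt_apply Γ t (ρ x) (modelDeriv 𝓘(ℝ, R3) ρ x X)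
  obtain ⟨q0, q1, q2⟩ := c.coframeAt_apply Γ s x X
  rw [h.coframeAt, q0] at p0
  rw [h.coframeAt, q1] at p1
  rw [h.coframeAt, q2] at p2
  have hl' : c.b₂ t ^ 2 + c.b₃ t ^ 2 = c.l t := rfl
  set Y := modelDeriv 𝓘(ℝ, R3) ρ x X
  have r1 : Y 1 = c.b₂ t * (c.b₂ t / c.l t * Y 1 + c.b₃ t / c.l t * Y 2)
      - c.b₃ t * (-(c.b₃ t / c.l t) * Y 1 + c.b₂ t / c.l t * Y 2) := by
    field_simp
    linear_combination -Y 1 * hl'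
  have r2 : Y 2 = c.b₃ t * (c.b₂ t / c.l t * Y 1 + c.b₃ t / c.l t * Y 2)
      + c.b₂ t * (-(c.b₃ t / c.l t) * Y 1 + c.b₂ t / c.l t * Y 2) := by
    field_simp
    linear_combination -Y 2 * hl'
  refine ⟨?_, ?_, ?_⟩
  · have : Y 0 = c.a₁ t * (1 / c.a₁ t * Y 0) := by field_simp
    rw [this, ← p0]
    ring
  · rw [r1, ← p1, ← p2]
    ring
  · rw [r2, ← p1, ← p2]
    ring

/-- This is `|b(t)/b(s)|² = l(t)/l(s)` for `b = b₂ + i b₃`. -/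
theorem conformal_factor (t : ℝ) {s : ℝ} (hl : c.l s ≠ 0) :
    ((c.b₂ t * c.b₂ s + c.b₃ t * c.b₃ s) / c.l s) ^ 2
      + ((c.b₃ t * c.b₂ s - c.b₂ t * c.b₃ s) / c.l s) ^ 2 = c.l t / c.l s := by
  field_simp
  simp only [l]
  ring

/-- Division by zero gives zero: `e¹ = 0` if `a₁ t = 0`, and `e² = e³ = 0` if `l t = 0`.
Nondegeneracy of the coefficients is thus visible in the coframe, and it can be transported by `ρ`
to times outside `[0, 1]`. -/
theorem coframeAt_injective_iff (t : ℝ) (x : Torus Γ) :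
    (∀ X, (∀ i, c.coframeAt Γ t x i X = 0) → X = 0) ↔ c.a₁ t ≠ 0 ∧ 0 < c.l t := by
  have hl0 : 0 ≤ c.l t := add_nonneg (sq_nonneg _) (sq_nonneg _)
  constructor
  · intro h
    refine ⟨fun ha => ?_, hl0.lt_of_ne fun hl => ?_⟩
    · have h1 := h (EuclideanSpace.single 0 1) fun i => by
        obtain ⟨h0, h1, h2⟩ := c.coframeAt_apply Γ t x (EuclideanSpace.single 0 1)
        fin_cases i
        · exact h0.trans (by simp [ha])
        · exact h1.trans (by simp)
        · exact h2.trans (by simp)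
      simpa using congrArg (fun X : R3 => X 0) h1
    · have h1 := h (EuclideanSpace.single 1 1) fun i => by
        obtain ⟨h0, h1, h2⟩ := c.coframeAt_apply Γ t x (EuclideanSpace.single 1 1)
        fin_cases i
        · exact h0.trans (by simp)
        · exact h1.trans (by simp [← hl])
        · exact h2.trans (by simp [← hl])
      simpa using congrArg (fun X : R3 => X 1) h1
  · rintro ⟨ha, hl⟩ X hX
    obtain ⟨h0, h1, h2⟩ := c.coframeAt_apply Γ t x X
    rw [hX] at h0 h1 h2
    have hl' : c.b₂ t ^ 2 + c.b₃ t ^ 2 = c.l t := rfl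
    have hlne := hl.ne'
    field_simp at h0 h1 h2
    ext i
    fin_cases i
    · exact h0.symm.trans (zero_mul _)
    · refine (mul_eq_zero.1 (?_ : c.l t * X 1 = 0)).resolve_left hlne
      linear_combination -c.b₂ t * h1 + c.b₃ t * h2 - X 1 * hl'
    · refine (mul_eq_zero.1 (?_ : c.l t * X 2 = 0)).resolve_left hlne
      linear_combination -c.b₃ t * h1 - c.b₂ t * h2 - X 2 * hl'

theorem PullsBack.nondegenerate_iff {t s : ℝ} (h : c.PullsBack Γ ρ t s) :
    c.a₁ t ≠ 0 ∧ 0 < c.l t ↔ c.a₁ s ≠ 0 ∧ 0 < c.l s := by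
  let x : Torus Γ := Torus.proj Γ 0
  have hs := MappingTorus.modelDeriv_surjective ρ x
  have hi : Function.Injective (modelDeriv 𝓘(ℝ, R3) ρ x) :=
    (ρ.mfderivToContinuousLinearEquiv (by simp) x).injective
  rw [← coframeAt_injective_iff t (ρ x), ← coframeAt_injective_iff s x, hs.forall]
  simp only [h.coframeAt]
  exact forall_congr' fun X => imp_congr_right fun _ => by rw [map_eq_zero_iff _ hi]

theorem forall_of_unit_interval {P : ℝ → Prop} (hP : ∀ t, P (t + 1) ↔ P t)
    (h : ∀ t ∈ Icc (0 : ℝ) 1, P t) (t : ℝ) : P t := by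
  have h1 : ∀ (n : ℤ) (t : ℝ), P (t + n) ↔ P t := fun n t => by
    induction n using Int.induction_on with
    | zero => simp
    | succ n ih =>
      rw [← ih, ← hP (t + ((n : ℤ) : ℝ))]
      push_cast
      rw [add_assoc]
    | pred n ih =>
      rw [← ih, ← hP (t + ((-n - 1 : ℤ) : ℝ))]
      push_cast
      rw [add_assoc, sub_add_cancel]
  rw [← Int.fract_add_floor t, h1]
  exact h _ ⟨Int.fract_nonneg t, (Int.fract_lt_one t).le⟩

theorem derivWithin_eqOn_deriv {f g : ℝ → ℝ} (hg : Differentiable ℝ g)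
    (hfg : EqOn f g (Icc 0 1)) {t : ℝ} (ht : t ∈ Icc (0 : ℝ) 1) :
    derivWithin f (Icc 0 1) t = deriv g t := by
  rw [derivWithin_congr hfg (hfg ht)]
  exact (hg t).derivWithin (uniqueDiffOn_Icc one_pos t ht)

open MappingTorus

/-- A coframe that glues smoothly gives an invariant family. -/
theorem isInvariantFamily_of_forall_pullsBack (ha : ContDiff ℝ ∞ c.a₁) (hb₂ : ContDiff ℝ ∞ c.b₂)
    (hb₃ : ContDiff ℝ ∞ c.b₃) (h : ∀ t, c.PullsBack Γ ρ (t + 1) t)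
    (hnd : ∀ t ∈ Icc (0 : ℝ) 1, c.a₁ t ≠ 0 ∧ 0 < c.l t) {C : ℝ} (hC : C ≠ 0)
    (hd : ∀ t ∈ Icc (0 : ℝ) 1, deriv (fun s => (c.l s)⁻¹) t = C * c.a₁ t) :
    IsInvariantFamily ρ c.a₁ c.l C := by
  have hnd' : ∀ t, c.a₁ t ≠ 0 ∧ 0 < c.l t :=
    forall_of_unit_interval (fun t => (h t).nondegenerate_iff) hnd
  have hl : ContDiff ℝ ∞ c.l := (hb₂.pow 2).add (hb₃.pow 2)
  have hdiff : Differentiable ℝ fun s => (c.l s)⁻¹ :=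
    (hl.inv fun t => (hnd' t).2.ne').differentiable (by simp)
  -- The differential of `ρ` at a fixed point does not depend on `t`. Comparing its expressions at
  -- time `t` and at time `0` shows that the ratios `a₁(t+1)/a₁(t)` and `l(t+1)/l(t)` are constant.
  have hLt := fun t => (h t).modelDeriv_apply (hnd' _).1 (hnd' _).2.ne' (Torus.proj Γ 0)
  have hL0 := (h 0).modelDeriv_apply (hnd' _).1 (hnd' _).2.ne'
  obtain ⟨r, hr⟩ : ∃ r, r = c.a₁ (0 + 1) / c.a₁ 0 := ⟨_, rfl⟩
  obtain ⟨α, hα⟩ : ∃ α, α = (c.b₂ (0 + 1) * c.b₂ 0 + c.b₃ (0 + 1) * c.b₃ 0) / c.l 0 := ⟨_, rfl⟩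
  obtain ⟨β, hβ⟩ : ∃ β, β = (c.b₃ (0 + 1) * c.b₂ 0 - c.b₂ (0 + 1) * c.b₃ 0) / c.l 0 := ⟨_, rfl⟩
  rw [← hr, ← hα, ← hβ] at hL0
  have ha1 : ∀ t, c.a₁ (t + 1) = r * c.a₁ t := fun t => by
    have h1 := (hLt t (EuclideanSpace.single 0 1)).1
    rw [(hL0 _ _).1] at h1
    have := (hnd' t).1
    simp at h1
    field_simp at h1
    exact h1.symm
  have hl1 : ∀ t, c.l (t + 1) = (α ^ 2 + β ^ 2) * c.l t := fun t => by
    have h1 := (hLt t (EuclideanSpace.single 1 1)).2.1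
    have h2 := (hLt t (EuclideanSpace.single 1 1)).2.2
    have h3 := conformal_factor (c := c) (t + 1) (hnd' t).2.ne'
    rw [(hL0 _ _).2.1] at h1
    rw [(hL0 _ _).2.2] at h2
    simp at h1 h2
    rw [h1, h2, h3, div_mul_cancel₀ _ (hnd' t).2.ne']
  have hm : α ^ 2 + β ^ 2 ≠ 0 := fun h0 => (hnd' 1).2.ne' (by simpa [h0] using hl1 0)
  have hder : ∀ t, deriv (fun s => (c.l s)⁻¹) (t + 1) =
      (α ^ 2 + β ^ 2)⁻¹ * deriv (fun s => (c.l s)⁻¹) t := fun t => by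
    rw [← deriv_comp_add_const, ← deriv_const_mul _ (hdiff t)]
    congr 1
    funext s
    rw [hl1, mul_inv]
  -- The equation `(l⁻¹)' = C a₁` holds at both `0` and `1`. From `0` to `1` its left side scales by
  -- `(α² + β²)⁻¹` and its right side by `r`, and `C a₁(0) ≠ 0`.
  have hrm : r = (α ^ 2 + β ^ 2)⁻¹ := by
    have h1 := hder 0
    rw [hd 0 (by simp), zero_add, hd 1 (by simp)] at h1
    have h2 := ha1 0
    rw [zero_add] at h2
    rw [h2] at h1
    have := (hnd' 0).1
    exact mul_right_cancel₀ (mul_ne_zero hC this) (by linear_combination h1)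
  refine ⟨ha, hl, fun t => (hnd' t).1, fun t => (hnd' t).2, fun t => ?_, r, α, β, ?_, ha1, hl1,
    hL0⟩
  · have := forall_of_unit_interval (P := fun t => deriv (fun s => (c.l s)⁻¹) t = C * c.a₁ t)
      (fun t => ?_) hd t
    · rw [← this]
      exact (hdiff t).hasDerivAt
    · rw [hder, ha1, hrm, mul_left_comm, mul_right_inj' (inv_ne_zero hm)]
  · rw [hrm, inv_mul_cancel₀ hm]

theorem IsAdmissible.differentiableOn_b₂ (hc : c.IsAdmissible) :
    DifferentiableOn ℝ c.b₂ (Icc 0 1) := hc.smooth_b₂.differentiableOn (by simp)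

theorem IsAdmissible.differentiableOn_b₃ (hc : c.IsAdmissible) :
    DifferentiableOn ℝ c.b₃ (Icc 0 1) := hc.smooth_b₃.differentiableOn (by simp)

theorem IsAdmissible.derivWithin_inv_l (hc : c.IsAdmissible) {t : ℝ} (ht : t ∈ Icc (0 : ℝ) 1) :
    derivWithin (fun s => 1 / c.l s) (Icc 0 1) t = -2 * c.v t / c.l t ^ 2 := by
  have h1 := ((hc.differentiableOn_b₂ t ht).hasDerivWithinAt.pow 2).add
    ((hc.differentiableOn_b₃ t ht).hasDerivWithinAt.pow 2)
  have h2 := (h1.inv (hc.l_pos t ht).ne').derivWithin (uniqueDiffOn_Icc one_pos t ht)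
  simp only [one_div]
  refine Eq.trans h2 ?_
  simp only [v, Pi.add_apply, Pi.pow_apply, l]
  ring

/-- In general, exponential functions with the same values at the end points of the unit interval
give an invariant family. -/
theorem IsAdmissible.exists_isInvariantFamily (hc : c.IsAdmissible) (h : c.PullsBack Γ ρ 1 0)
    {C : ℝ} (hC : C ≠ 0) (hd : ∀ t ∈ Icc (0 : ℝ) 1,
      derivWithin (fun s => 1 / c.l s) (Icc 0 1) t * (1 / c.a₁ t) = C) :
    ∃ (a l : ℝ → ℝ) (C : ℝ), IsInvariantFamily ρ a l C := by
  have m0 : (0 : ℝ) ∈ Icc (0 : ℝ) 1 := by simp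
  have m1 : (1 : ℝ) ∈ Icc (0 : ℝ) 1 := by simp
  have a0 := hc.a₁_ne_zero 0 m0
  have a1 := hc.a₁_ne_zero 1 m1
  have l0 := hc.l_pos 0 m0
  have l1 := hc.l_pos 1 m1
  have hm : 0 < c.l 1 / c.l 0 := div_pos l1 l0
  -- From `(1/l)' = -2v/l²` one gets `C a₁ l = -2 v/l`, and `v/l` has equal values at the end
  -- points.
  have hal : c.a₁ 1 / c.a₁ 0 * (c.l 1 / c.l 0) = 1 := by
    have e0 := hd 0 m0
    have e1 := hd 1 m1
    rw [hc.derivWithin_inv_l m0] at e0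
    rw [hc.derivWithin_inv_l m1] at e1
    have hv := hc.v_eq
    have f0 : C * (c.a₁ 0 * c.l 0) = -2 * (c.v 0 / c.l 0) := by
      rw [← e0]
      field_simp
    have f1 : C * (c.a₁ 1 * c.l 1) = -2 * (c.v 1 / c.l 1) := by
      rw [← e1]
      field_simp
    rw [hv, ← f0] at f1
    have := mul_left_cancel₀ hC f1
    field_simp
    exact this
  -- This exponent makes `l(0) e^{kt}` and `a₁(0) e^{-kt}` take the prescribed values at `t = 1`.
  -- Their product is constant, so `(l⁻¹)' = -k l⁻¹` is a constant multiple of `a`.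
  set k := Real.log (c.l 1 / c.l 0) with hk
  have hek : Real.exp k = c.l 1 / c.l 0 := Real.exp_log hm
  refine ⟨fun t => c.a₁ 0 * Real.exp (-(k * t)), fun t => c.l 0 * Real.exp (k * t),
    -k / (c.l 0 * c.a₁ 0), ?_, ?_, fun t => mul_ne_zero a0 (Real.exp_ne_zero _),
    fun t => mul_pos l0 (Real.exp_pos _), fun t => ?_, c.a₁ 1 / c.a₁ 0, _, _, ?_, fun t => ?_,
    fun t => ?_, h.modelDeriv_apply a1 l1.ne'⟩
  · exact contDiff_const.mul (contDiff_const.mul contDiff_id).neg.exp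
  · exact contDiff_const.mul (contDiff_const.mul contDiff_id).exp
  · have h1 : HasDerivAt (fun s => (c.l 0)⁻¹ * Real.exp (-(k * s)))
        ((c.l 0)⁻¹ * (Real.exp (-(k * t)) * -(k * 1))) t :=
      (((hasDerivAt_id t).const_mul k).neg.exp).const_mul _
    convert h1 using 1
    · funext s
      rw [mul_inv, Real.exp_neg]
    · field_simp
  · rw [conformal_factor 1 l0.ne', hal]
  · have h1 : Real.exp (-k) = c.a₁ 1 / c.a₁ 0 := by
      rw [Real.exp_neg, hek]
      exact (eq_inv_of_mul_eq_one_left hal).symm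
    rw [← h1, mul_add, mul_one, neg_add, Real.exp_add]
    ring
  · rw [conformal_factor 1 l0.ne', ← hek, mul_add, mul_one, Real.exp_add]
    ring

end FrameCoeffs

/-! ### Comparison with the explicit structure -/

namespace MappingTorus

open SplitModel

variable {Γ : Submodule ℤ R3} [DiscreteTopology Γ]
  {E N : Type*} [NormedAddCommGroup E] [NormedSpace ℝ E] [TopologicalSpace N] [ChartedSpace E N]
  [IsManifold 𝓘(ℝ, E) ∞ N] [T2Space N] [LocallyCompactSpace N]
  {ρ : Torus Γ ≃ₘ⟮𝓘(ℝ, R3), 𝓘(ℝ, R3)⟯ Torus Γ} {ψ : N ≃ₘ⟮𝓘(ℝ, E), 𝓘(ℝ, E)⟯ N}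
  {a l : ℝ → ℝ} {C : ℝ} (h : IsInvariantFamily ρ a l C)
  {K : KahlerStructure 𝓘(ℝ, E) N} (hψ : K.IsPreservedBy ψ) {c : FrameCoeffs}

omit [DiscreteTopology Γ] [T2Space N] [LocallyCompactSpace N] in
theorem coverCplx_eq (σ : ℝ) (y : (Torus Γ × N) × ℝ) {X Y : R3} {ξ ζ : E} {r s : ℝ}
    (h0 : -(a y.2 * r) = Y 0) (h1 : -(σ * X 2) = Y 1) (h2 : σ * X 1 = Y 2)
    (hN : K.cpx.endo y.1.2 ξ = ζ) (ht : (a y.2)⁻¹ * X 0 = s) :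
    coverCplx a K σ y ((X, ξ), r) = ((Y, ζ), s) := by
  obtain ⟨k0, k1, k2, k3, k4⟩ := cplx_apply σ (a y.2) (K.cpx.endo y.1.2) ((X, ξ), r)
  exact ext_coords (k0.trans h0) (k1.trans h1) (k2.trans h2) (k3.trans hN) (k4.trans ht)

-- The covectors `e²`, `e³` are `dx²`, `dx³` rotated and scaled by `l^{-1/2}`, so the sum of their
-- squares involves `b₂`, `b₃` only through `l`.
omit [T2Space N] [LocallyCompactSpace N] in
theorem coverMet_eq {t : ℝ} (ha : a t = c.a₁ t) (hl : l t = c.l t) (hl0 : l t ≠ 0) (x : Torus Γ)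
    (p : N) (X Y : R3) (ξ ζ : E) (r s : ℝ) :
    coverMet a l K ((x, p), t) ((X, ξ), r) ((Y, ζ), s) =
      ∑ i, c.coframeAt Γ t x i X * c.coframeAt Γ t x i Y + metricAt K.metric p ξ ζ + r * s := by
  obtain ⟨p0, p1, p2⟩ := c.coframeAt_apply Γ t x X
  obtain ⟨q0, q1, q2⟩ := c.coframeAt_apply Γ t x Y
  have hl' : c.b₂ t ^ 2 + c.b₃ t ^ 2 = c.l t := rfl
  rw [coverMet, met_apply, Fin.sum_univ_three, p0, p1, p2, q0, q1, q2, ha, hl]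
  rw [hl] at hl0
  congr 2
  field_simp
  linear_combination -(X 1 * Y 1 + X 2 * Y 2) * hl'

/-- `pushTangent` is the differential of the quotient map, so by `dmk_intertwines` each formula is a
computation in coordinates on the cover. -/
theorem isExplicit_splitStructure [CompleteSpace E]
    (hac : ∀ t ∈ Icc (0 : ℝ) 1, a t = c.a₁ t) (hlc : ∀ t ∈ Icc (0 : ℝ) 1, l t = c.l t) :
    IsExplicit c K (ρ.prodCongr ψ) (splitStructure h hψ) := by
  have key : ∀ (σ : ℝ) (x : Torus Γ) (p : N) (t : ℝ) (X Y : R3) (ξ ζ : E) (r s : ℝ),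
      -(a t * r) = Y 0 → -(σ * X 2) = Y 1 → σ * X 1 = Y 2 → K.cpx.endo p ξ = ζ →
      (a t)⁻¹ * X 0 = s →
      cplxField ρ ψ a K σ (mk (ρ.prodCongr ψ) ((x, p), t))
        (pushTangent (ρ.prodCongr ψ) x p t X ξ r) = pushTangent (ρ.prodCongr ψ) x p t Y ζ s :=
    fun σ x p t X Y ξ ζ r s h0 h1 h2 hN ht =>
      ((dmk_intertwines h hψ ((x, p), t)).1 σ ((X, ξ), r)).trans
        (congrArg (dmk (ρ.prodCongr ψ) ((x, p), t)) (coverCplx_eq σ ((x, p), t) h0 h1 h2 hN ht))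
  have hneg : ∀ (x : Torus Γ) (p : N) (t : ℝ) (X : R3),
      pushTangent (ρ.prodCongr ψ) x p t (-X) (0 : E) 0 =
        -pushTangent (ρ.prodCongr ψ) x p t X (0 : E) 0 := fun x p t X => by
    refine Eq.trans ?_ (map_neg (dmk (ρ.prodCongr ψ) ((x, p), t)) ((X, 0), 0))
    refine congrArg (dmk (ρ.prodCongr ψ) ((x, p), t)) ?_
    rw [Prod.neg_mk, Prod.neg_mk, neg_zero, neg_zero]
  have hf := fun (t : ℝ) (x : Torus Γ) => c.frameAt_eq Γ t x
  have h0 : ∀ t ∈ Icc (0 : ℝ) 1, c.a₁ t ≠ 0 := fun t ht => hac t ht ▸ h.a_ne_zero t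
  have hJ0 : ∀ p : N, K.cpx.endo p 0 = 0 := fun p => map_zero _
  refine ⟨fun x p t ht X Y ξ ζ r s => ?_, fun x p t ht => ?_, fun x p t ht => ?_,
    fun x p t ht => ?_, fun x p t ht ξ => ?_, fun x p t ht => ?_, fun x p t ht => ?_,
    fun x p t ht => ?_, fun x p t ht ξ => ?_⟩
  · refine ((dmk_intertwines h hψ ((x, p), t)).2.1 ((X, ξ), r) ((Y, ζ), s)).trans ?_
    exact coverMet_eq (E := E) (hac t ht) (hlc t ht) (h.l_pos t).ne' x p X Y ξ ζ r s
  · refine key 1 x p t (c.frameAt Γ t x 0) 0 0 0 0 1 ?_ ?_ ?_ (hJ0 p) ?_ <;>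
      simp [(hf t x).1, hac t ht, h0 t ht]
  · refine key 1 x p t (c.frameAt Γ t x 1) (c.frameAt Γ t x 2) 0 0 0 0 ?_ ?_ ?_ (hJ0 p) ?_ <;>
      simp [(hf t x).2.1, (hf t x).2.2]
  · refine (key 1 x p t (c.frameAt Γ t x 2) (-c.frameAt Γ t x 1) 0 0 0 0 ?_ ?_ ?_ (hJ0 p) ?_).trans
      (hneg _ _ _ _) <;> simp [(hf t x).2.1, (hf t x).2.2]
  · refine key 1 x p t 0 0 ξ _ 0 0 ?_ ?_ ?_ rfl ?_ <;> simp
  · refine key (-1) x p t (c.frameAt Γ t x 0) 0 0 0 0 1 ?_ ?_ ?_ (hJ0 p) ?_ <;>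
      simp [(hf t x).1, hac t ht, h0 t ht]
  · refine (key (-1) x p t (c.frameAt Γ t x 1) (-c.frameAt Γ t x 2) 0 0 0 0 ?_ ?_ ?_
      (hJ0 p) ?_).trans (hneg _ _ _ _) <;> simp [(hf t x).2.1, (hf t x).2.2]
  · refine key (-1) x p t (c.frameAt Γ t x 2) (c.frameAt Γ t x 1) 0 0 0 0 ?_ ?_ ?_ (hJ0 p) ?_ <;>
      simp [(hf t x).2.1, (hf t x).2.2]
  · refine key (-1) x p t 0 0 ξ _ 0 0 ?_ ?_ ?_ rfl ?_ <;> simp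

end MappingTorus

theorem theorem3p3
    (Γ : Submodule ℤ R3) [DiscreteTopology Γ] [IsZLattice ℝ Γ]
    {E N : Type*} [NormedAddCommGroup E] [NormedSpace ℝ E] [FiniteDimensional ℝ E]
    [TopologicalSpace N] [T2Space N] [CompactSpace N] [ChartedSpace E N]
    [IsManifold 𝓘(ℝ, E) ∞ N] (K : KahlerStructure 𝓘(ℝ, E) N)
    (c : FrameCoeffs) (hc : c.IsAdmissible)
    (ρ : Torus Γ ≃ₘ⟮𝓘(ℝ, R3), 𝓘(ℝ, R3)⟯ Torus Γ) (hρ : c.PullsBack Γ ρ 1 0)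
    (hconst : ∃ C : ℝ, C ≠ 0 ∧ ∀ t ∈ Set.Icc (0 : ℝ) 1,
      derivWithin (fun s => 1 / c.l s) (Set.Icc 0 1) t * (1 / c.a₁ t) = C)
    (ψ : N ≃ₘ⟮𝓘(ℝ, E), 𝓘(ℝ, E)⟯ N) (hψ : K.IsPreservedBy ψ) :
    ∃ S : GenKahlerStructure ((modelTN E).prod 𝓘(ℝ, ℝ)) (MappingTorus (ρ.prodCongr ψ)),
      S.IsSplit ∧ (c.GluesSmoothly Γ ρ → IsExplicit c K (ρ.prodCongr ψ) S) := by
  have : CompleteSpace E := FiniteDimensional.complete ℝ E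
  obtain ⟨C, hC, hd⟩ := hconst
  -- One structure has to serve both claims. When the coframe glues, it is built from the extended
  -- coefficients; otherwise the second claim is vacuous and the exponential family suffices.
  by_cases hg : c.GluesSmoothly Γ ρ
  · obtain ⟨c', ha, hb₂, hb₃, hcc, hpb⟩ := hg
    have hl : EqOn c.l c'.l (Icc 0 1) := fun t ht => by
      rw [FrameCoeffs.l, FrameCoeffs.l, (hcc t ht).2.1, (hcc t ht).2.2]
    have hnd : ∀ t ∈ Icc (0 : ℝ) 1, c'.a₁ t ≠ 0 ∧ 0 < c'.l t := fun t ht => by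
      rw [(hcc t ht).1, ← hl ht]
      exact ⟨hc.a₁_ne_zero t ht, hc.l_pos t ht⟩
    -- The extension `c'` is known to be nondegenerate only on `[0, 1]`; pulling back by `ρ` spreads
    -- this to all times.
    have hnd' := FrameCoeffs.forall_of_unit_interval (fun t => (hpb t).nondegenerate_iff) hnd
    have hdiff : Differentiable ℝ fun s => (c'.l s)⁻¹ :=
      (((hb₂.pow 2).add (hb₃.pow 2)).inv fun t => (hnd' t).2.ne').differentiable (by simp)
    have hinv := FrameCoeffs.isInvariantFamily_of_forall_pullsBack ha hb₂ hb₃ hpb hnd hC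
      fun t ht => by
        rw [← hd t ht, (hcc t ht).1, mul_assoc, one_div_mul_cancel (hc.a₁_ne_zero t ht), mul_one]
        refine (FrameCoeffs.derivWithin_eqOn_deriv hdiff (fun s hs => ?_) ht).symm
        rw [hl hs, one_div]
    exact ⟨MappingTorus.splitStructure hinv hψ, MappingTorus.isSplit_splitStructure hinv hψ,
      fun _ => MappingTorus.isExplicit_splitStructure hinv hψ (fun t ht => (hcc t ht).1)
        fun t ht => (hl ht).symm⟩
  · obtain ⟨a, l, C', h⟩ := hc.exists_isInvariantFamily hρ hC hd
    exact ⟨MappingTorus.splitStructure h hψ, MappingTorus.isSplit_splitStructure h hψ,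
      fun h => absurd h hg⟩
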